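/- Let $|\mathbb{S}^4|=\frac{8\pi^2}{3}$ be the volume of the standard unit sphere $\mathbb{S}^4\subset\mathbb{R}^5$, let $Q$ be a real polynomial on $\mathbb{R}^4$, and let $u:\mathbb{R}^4\to\mathbb{R}$ be a smooth function. Suppose that $u$ is a normal solution of $(-\Delta)^2u=Qe^{4u}$ on $\mathbb{R}^4$, that is: $u$ satisfies this equation, $Qe^{4u}\in L^1(\mathbb{R}^4)$, and there is a constant $C\in\mathbb{R}$ such that $$u(x)=\frac{2}{6\,|\mathbb{S}^4|}\int_{\mathbb{R}^4}\log\frac{|y|}{|x-y|}\,Q(y)e^{4u(y)}\,\mathrm{d}y+C\qquad\text{for all }x\in\mathbb{R}^4.$$ If $Q(x)\le 6$ for all $x\in\mathbb{R}^4$, then $$\int_{\mathbb{R}^4}e^{4u}\,\mathrm{d}x\ \ge\ |\mathbb{S}^4|$$ (the integral may be $+\infty$), with equality if and only if $Q\equiv 6$. -/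

import Mathlib

open MeasureTheory

/-- Euclidean four-space, with the Euclidean norm and Lebesgue measure. -/
abbrev E4 : Type := EuclideanSpace ℝ (Fin 4)

/-- The volume `|𝕊⁴|` of the standard four-sphere: the total mass of the surface measure on the
unit sphere of `ℝ⁵`. -/
noncomputable def volS4 : ENNReal :=
  (volume : Measure (EuclideanSpace ℝ (Fin 5))).toSphere Set.univ

/-- `u` is a smooth normal solution on `ℝ⁴` of `(-Δ)² u = Q e^{4u}`. Since the integrand
`Q e^{4u}` is integrable and locally bounded, and `log (|y| / |x - y|)` tends to `0` as
`|y| → ∞` and has only logarithmic singularities, the integral in the last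
clause converges absolutely for every `x`. -/
structure IsNormalSolution (Q u : E4 → ℝ) : Prop where
  smooth : ContDiff ℝ (⊤ : ℕ∞) u
  /-- `Q e^{4u}` lies in `L¹`. -/
  integrable : Integrable (fun y : E4 => Q y * Real.exp (4 * u y))
  /-- The differential equation; in it `(-Δ)² = Δ Δ`. -/
  equation : ∀ x : E4,
    Laplacian.laplacian (Laplacian.laplacian u) x = Q x * Real.exp (4 * u x)
  /-- The integral equation, with `6 = (4 - 1)!`. -/
  integral_equation : ∃ C : ℝ, ∀ x : E4,
    u x = 2 / (6 * volS4.toReal) *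
      (∫ y : E4, Real.log (‖y‖ / ‖x - y‖) * (Q y * Real.exp (4 * u y))) + C

open Set Filter Topology Metric

open scoped RealInnerProductSpace

/-! Put c = 2/(6|𝕊⁴|), V = ∫ e^{4u} and α = c ∫ Q e^{4u}. The number |𝕊⁴| enters only through c ·
6|𝕊⁴| = 2, so α ≥ 2 means ∫ Q e^{4u} ≥ 6|𝕊⁴|. If V is infinite, the inequality is trivial and Q ≡ 6
is impossible.

For finite V two consequences of the integral equation suffice. The Pohozaev identity
(`pohozaev_identity`) says α(α − 2) = (c/2) ∫ (x − x₀)·∇Q e^{4u} whenever the last integrand is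
integrable. The growth bound (`one_add_div_four_le_of_growth`) says α ≥ 1 + deg Q / 4 for Q ≠ 0:
averages of u over dilates by R behave like −α log R, and by Jensen a smaller α would contradict
integrability of Q e^{4u}.

For constant Q, Pohozaev gives α = 2, that is QV = 6|𝕊⁴|. Otherwise deg Q is even, because Q is
bounded above. If deg Q ≥ 4, then α ≥ 2, and V > |𝕊⁴| since Q ≤ 6 with strict inequality somewhere.
If deg Q = 2, then Q has a maximum point x₀ with (x − x₀)·∇Q = 2(Q − Q(x₀)), and Pohozaev reads c
Q(x₀) V = α(3 − α). Growth gives α > 1 and maximality of Q(x₀) gives α < 2, so α(3 − α) > 2 and 6V ≥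
Q(x₀)V > 6|𝕊⁴|. -/

/-! ### Integrability of the kernels 1/|x − y| and log(|y|/|x − y|) -/

theorem integrable_indicator_inv_norm :
    Integrable ((ball (0 : E4) 1).indicator (fun z => ‖z‖⁻¹)) := by
  rw [integrable_indicator_iff measurableSet_ball]
  refine integrableOn_ball_of_norm_le_rpow (C := 1) (α := 1) (by simp) (by simp)
    (Eventually.of_forall fun x => ?_) (by fun_prop)
  rw [Real.rpow_neg_one]; simp

theorem inv_norm_le_one_add_indicator (z : E4) :
    ‖z‖⁻¹ ≤ 1 + (ball (0 : E4) 1).indicator (fun z => ‖z‖⁻¹) z := by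
  by_cases hz : z ∈ ball (0 : E4) 1
  · simp [indicator_of_mem hz]
  · rw [indicator_of_notMem hz, add_zero]
    exact inv_le_one_of_one_le₀ (by simpa using hz)

theorem integrableOn_inv_norm_sub {s : Set E4} (hs : volume s ≠ ⊤) (y : E4) :
    IntegrableOn (fun x => ‖x - y‖⁻¹) s := by
  have h : IntegrableOn (fun x => 1 + (ball (0 : E4) 1).indicator (fun z => ‖z‖⁻¹) (x - y)) s :=
    (integrableOn_const hs).add (integrable_indicator_inv_norm.comp_sub_right y).integrableOn
  refine h.mono' (by fun_prop) (Eventually.of_forall fun x => ?_)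
  simpa using inv_norm_le_one_add_indicator (x - y)

/-- Translation invariance of the singular part makes the bound independent of y, which the later
uses of Fubini with a merely integrable density require. -/
theorem setIntegral_inv_norm_sub_le {s : Set E4} (hs : volume s ≠ ⊤) (y : E4) :
    ∫ x in s, ‖x - y‖⁻¹ ≤
      volume.real s + ∫ z, (ball (0 : E4) 1).indicator (fun z => ‖z‖⁻¹) z := by
  have h1 : IntegrableOn (fun _ : E4 => (1 : ℝ)) s := integrableOn_const hs
  have h2 := integrable_indicator_inv_norm.comp_sub_right y
  calc ∫ x in s, ‖x - y‖⁻¹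
      ≤ ∫ x in s, (1 + (ball (0 : E4) 1).indicator (fun z => ‖z‖⁻¹) (x - y)) :=
        integral_mono (integrableOn_inv_norm_sub hs y) (h1.add h2.integrableOn)
          fun x => inv_norm_le_one_add_indicator (x - y)
    _ = volume.real s + ∫ x in s, (ball (0 : E4) 1).indicator (fun z => ‖z‖⁻¹) (x - y) := by
        rw [integral_add h1 h2.integrableOn]; simp
    _ ≤ volume.real s + ∫ x, (ball (0 : E4) 1).indicator (fun z => ‖z‖⁻¹) (x - y) := by
        gcongr
        · exact Eventually.of_forall fun x => indicator_nonneg (fun z _ => by positivity) _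
        · exact Measure.restrict_le_self
    _ = _ := by rw [integral_sub_right_eq_self (fun z => (ball (0 : E4) 1).indicator (fun z => ‖z‖⁻¹) z)]

/-- Apply log t ≤ t − 1 to the ratio and to its inverse, then the triangle inequality. The bound has
only locally integrable singularities in y and decays at infinity, so it dominates the kernel in
Fubini arguments. -/
theorem abs_log_div_norm_le (x y : E4) :
    |Real.log (‖y‖ / ‖x - y‖)| ≤ ‖x‖ * (‖x - y‖⁻¹ + ‖y‖⁻¹) := by
  rcases eq_or_ne y 0 with rfl | hy
  · simp only [norm_zero, zero_div, Real.log_zero, abs_zero]; positivity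
  rcases eq_or_ne x y with rfl | hxy
  · simp only [sub_self, norm_zero, div_zero, Real.log_zero, abs_zero]; positivity
  have h1 : 0 < ‖y‖ := norm_pos_iff.2 hy
  have h2 : 0 < ‖x - y‖ := norm_pos_iff.2 (sub_ne_zero.2 hxy)
  have h3 : ‖y‖ ≤ ‖x‖ + ‖x - y‖ := by simpa using norm_sub_le x (x - y)
  have h4 : ‖x - y‖ ≤ ‖x‖ + ‖y‖ := norm_sub_le x y
  have e1 : ‖y‖ / ‖x - y‖ - 1 ≤ ‖x‖ * ‖x - y‖⁻¹ := by
    rw [← div_eq_mul_inv, sub_le_iff_le_add, div_add_one h2.ne']; gcongr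
  have e2 : ‖x - y‖ / ‖y‖ - 1 ≤ ‖x‖ * ‖y‖⁻¹ := by
    rw [← div_eq_mul_inv, sub_le_iff_le_add, div_add_one h1.ne']; gcongr
  have l1 := Real.log_le_sub_one_of_pos (div_pos h1 h2)
  have l2 := Real.log_le_sub_one_of_pos (div_pos h2 h1)
  have l3 : Real.log (‖x - y‖ / ‖y‖) = - Real.log (‖y‖ / ‖x - y‖) := by
    rw [← Real.log_inv, inv_div]
  have p1 : 0 ≤ ‖x‖ * ‖x - y‖⁻¹ := by positivity
  have p2 : 0 ≤ ‖x‖ * ‖y‖⁻¹ := by positivity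
  rw [abs_le, mul_add]
  constructor <;> linarith

theorem abs_log_le_add_inv {t : ℝ} (ht : 0 ≤ t) : |Real.log t| ≤ t + t⁻¹ := by
  rcases ht.eq_or_lt with rfl | ht
  · simp
  have l1 := Real.log_le_sub_one_of_pos ht
  have l2 := Real.log_le_sub_one_of_pos (inv_pos.2 ht)
  rw [Real.log_inv] at l2
  have := inv_pos.2 ht
  rw [abs_le]; constructor <;> linarith

theorem integrable_inv_norm_mul {ρ : E4 → ℝ} (hc : Continuous ρ) (hi : Integrable ρ) :
    Integrable (fun y => ‖y‖⁻¹ * ρ y) := by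
  have hs : volume (closedBall (0 : E4) 1) ≠ ⊤ := measure_closedBall_lt_top.ne
  rw [← integrableOn_univ, ← union_compl_self (closedBall (0 : E4) 1)]
  refine IntegrableOn.union ?_ ?_
  · have := integrableOn_inv_norm_sub hs 0
    simp only [sub_zero] at this
    exact this.mul_continuousOn hc.continuousOn (isCompact_closedBall _ _)
  · refine Integrable.mono hi.integrableOn (by fun_prop) ?_
    refine (ae_restrict_iff' measurableSet_closedBall.compl).2 (Eventually.of_forall fun y hy => ?_)
    rw [norm_mul, norm_inv, norm_norm]
    have : 1 ≤ ‖y‖ := by simp at hy; exact hy.le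
    exact mul_le_of_le_one_left (norm_nonneg _) (inv_le_one_of_one_le₀ this)

theorem integrable_inv_norm_sub_mul {h : E4 → ℝ} (hc : Continuous h) (hs : HasCompactSupport h)
    (y : E4) : Integrable (fun x => ‖x - y‖⁻¹ * h x) := by
  rw [← integrableOn_iff_integrable_of_support_subset (s := tsupport h)
    ((Function.support_mul_subset_right _ _).trans (subset_tsupport h))]
  exact (integrableOn_inv_norm_sub hs.isCompact.measure_lt_top.ne y).mul_continuousOn
    hc.continuousOn hs.isCompact

/-! ### Integration by parts and the weak gradient of the potential -/

theorem HasCompactSupport.fderiv_apply_const {g : E4 → ℝ} (hs : HasCompactSupport g) (v : E4) :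
    HasCompactSupport (fun x => fderiv ℝ g x v) :=
  (hs.fderiv ℝ).comp_left (g := fun L : E4 →L[ℝ] ℝ => L v) rfl

theorem ContDiff.continuous_fderiv_apply_const {g : E4 → ℝ} (hg : ContDiff ℝ 1 g) (v : E4) :
    Continuous (fun x => fderiv ℝ g x v) :=
  (hg.continuous_fderiv one_ne_zero).clm_apply continuous_const

/-- Integration by parts against a compactly supported `C¹` function. -/
theorem integral_mul_fderiv_eq_neg_of_hasCompactSupport {f g : E4 → ℝ} (hf : ContDiff ℝ 1 f)
    (hg : ContDiff ℝ 1 g) (hs : HasCompactSupport g) (v : E4) :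
    ∫ x, f x * fderiv ℝ g x v = -∫ x, fderiv ℝ f x v * g x := by
  refine integral_mul_fderiv_eq_neg_fderiv_mul_of_integrable ?_ ?_ ?_
    (fun x _ => (hf.differentiable one_ne_zero) x) (fun x _ => (hg.differentiable one_ne_zero) x)
  · exact ((hf.continuous_fderiv_apply_const v).mul hg.continuous).integrable_of_hasCompactSupport
      hs.mul_left
  · exact (hf.continuous.mul (hg.continuous_fderiv_apply_const v)).integrable_of_hasCompactSupport
      (hs.fderiv_apply_const v).mul_left
  · exact (hf.continuous.mul hg.continuous).integrable_of_hasCompactSupport hs.mul_left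

theorem integral_fderiv_eq_zero_of_hasCompactSupport {g : E4 → ℝ}
    (hg : ContDiff ℝ 1 g) (hs : HasCompactSupport g) (v : E4) :
    ∫ x, fderiv ℝ g x v = 0 := by
  simpa using integral_mul_fderiv_eq_neg_of_hasCompactSupport (contDiff_const (c := (1 : ℝ))) hg hs v

/-- Adding ε smooths log ‖x − y‖, so that classical integration by parts applies before ε → 0. -/
theorem hasFDerivAt_half_log_norm_sq_add {ε : ℝ} (hε : 0 < ε) (y x : E4) :
    HasFDerivAt (fun x : E4 => 2⁻¹ * Real.log (‖x - y‖ ^ 2 + ε))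
      ((‖x - y‖ ^ 2 + ε)⁻¹ • innerSL ℝ (x - y)) x := by
  have h1 : HasFDerivAt (fun x : E4 => x - y) (ContinuousLinearMap.id ℝ E4) x :=
    (hasFDerivAt_id x).sub_const y
  have h2 := ((h1.norm_sq.add_const ε).log (by positivity)).const_mul (2⁻¹ : ℝ)
  refine h2.congr_fderiv ?_
  ext v
  simp
  ring

/-- The bound is uniform in ε: monotonicity of log gives the lower half, log s ≤ s − 1 with ε ≤ 1
the upper half. -/
theorem abs_half_log_sq_add_le {t ε : ℝ} (ht : 0 < t) (hε : 0 < ε) (hε1 : ε ≤ 1) :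
    |2⁻¹ * Real.log (t ^ 2 + ε)| ≤ t⁻¹ + (t + t ^ 2) := by
  have l1 := Real.log_le_sub_one_of_pos (show 0 < t ^ 2 + ε by positivity)
  have l2 : Real.log (t ^ 2) ≤ Real.log (t ^ 2 + ε) := Real.log_le_log (by positivity) (by linarith)
  rw [Real.log_pow] at l2
  have l3 := (abs_le.1 (abs_log_le_add_inv ht.le)).1
  have := inv_pos.2 ht
  push_cast at l2
  rw [abs_le]; constructor <;> nlinarith

theorem ae_ne_point (y : E4) : ∀ᵐ x : E4, x ≠ y := by
  simp [ae_iff]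

/-- The distributional gradient of `log ‖x - y‖` is `(x - y) / ‖x - y‖²`. -/
theorem integral_log_norm_sub_mul_fderiv {g : E4 → ℝ} (hg : ContDiff ℝ 1 g)
    (hs : HasCompactSupport g) (y v : E4) :
    ∫ x, Real.log ‖x - y‖ * fderiv ℝ g x v = -∫ x, g x * (⟪v, x - y⟫ / ‖x - y‖ ^ 2) := by
  have hgc := hg.continuous
  have hg' := hg.continuous_fderiv_apply_const v
  have hs' := hs.fderiv_apply_const v
  let ε : ℕ → ℝ := fun n => 1 / ((n : ℝ) + 1)
  have hε : ∀ n, 0 < ε n := fun n => Nat.one_div_pos_of_nat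
  have hε1 : ∀ n, ε n ≤ 1 := fun n => by
    simp only [ε]; rw [div_le_one (by positivity)]; linarith [n.cast_nonneg (α := ℝ)]
  have hε0 : Tendsto ε atTop (𝓝 0) := tendsto_one_div_add_atTop_nhds_zero_nat
  -- For positive ε this is ordinary integration by parts; both sides then pass to the limit by
  -- dominated convergence.
  have hibp : ∀ n, ∫ x, (2⁻¹ * Real.log (‖x - y‖ ^ 2 + ε n)) * fderiv ℝ g x v =
      -∫ x, g x * (⟪v, x - y⟫ / (‖x - y‖ ^ 2 + ε n)) := by
    intro n
    have hcd : ContDiff ℝ 1 (fun x : E4 => 2⁻¹ * Real.log (‖x - y‖ ^ 2 + ε n)) := by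
      refine contDiff_const.mul (ContDiff.log ?_ fun x => ?_)
      · exact ((contDiff_id.sub contDiff_const).norm_sq ℝ).add contDiff_const
      · have := hε n; positivity
    rw [integral_mul_fderiv_eq_neg_of_hasCompactSupport hcd hg hs v]
    congr 2 with x
    rw [(hasFDerivAt_half_log_norm_sq_add (hε n) y x).fderiv]
    rw [smul_apply, innerSL_apply_apply, real_inner_comm, smul_eq_mul]
    ring
  have hL : Tendsto (fun n => ∫ x, (2⁻¹ * Real.log (‖x - y‖ ^ 2 + ε n)) * fderiv ℝ g x v) atTop
      (𝓝 (∫ x, Real.log ‖x - y‖ * fderiv ℝ g x v)) := by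
    refine tendsto_integral_of_dominated_convergence
      (fun x => ‖x - y‖⁻¹ * |fderiv ℝ g x v| + (‖x - y‖ + ‖x - y‖ ^ 2) * |fderiv ℝ g x v|) ?_ ?_ ?_ ?_
    · intro n
      exact AEStronglyMeasurable.mul (Measurable.aestronglyMeasurable (by fun_prop))
        hg'.aestronglyMeasurable
    · refine (integrable_inv_norm_sub_mul hg'.abs hs'.abs y).add ?_
      exact Continuous.integrable_of_hasCompactSupport (by fun_prop) hs'.abs.mul_left
    · intro n
      filter_upwards [ae_ne_point y] with x hx
      rw [norm_mul, Real.norm_eq_abs, Real.norm_eq_abs, ← add_mul]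
      gcongr
      exact abs_half_log_sq_add_le (norm_pos_iff.2 (sub_ne_zero.2 hx)) (hε n) (hε1 n)
    · filter_upwards [ae_ne_point y] with x hx
      have hx' := norm_pos_iff.2 (sub_ne_zero.2 hx)
      have : Real.log ‖x - y‖ = 2⁻¹ * Real.log (‖x - y‖ ^ 2 + 0) := by
        rw [add_zero, Real.log_pow]; push_cast; ring
      rw [this]
      exact (((hε0.const_add _).log (by positivity)).const_mul _).mul_const _
  have hR : Tendsto (fun n => ∫ x, g x * (⟪v, x - y⟫ / (‖x - y‖ ^ 2 + ε n))) atTop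
      (𝓝 (∫ x, g x * (⟪v, x - y⟫ / ‖x - y‖ ^ 2))) := by
    refine tendsto_integral_of_dominated_convergence
      (fun x => ‖v‖ * (‖x - y‖⁻¹ * |g x|)) ?_ ?_ ?_ ?_
    · intro n
      refine hgc.aestronglyMeasurable.mul (Continuous.aestronglyMeasurable ?_)
      refine Continuous.div (by fun_prop) (by fun_prop) fun x => ?_
      have := hε n; positivity
    · exact (integrable_inv_norm_sub_mul hgc.abs hs.abs y).const_mul _
    · intro n
      filter_upwards [ae_ne_point y] with x hx
      have hx' := norm_pos_iff.2 (sub_ne_zero.2 hx)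
      have h1 := abs_real_inner_le_norm v (x - y)
      rw [norm_mul, Real.norm_eq_abs, Real.norm_eq_abs, abs_div,
        abs_of_pos (show 0 < ‖x - y‖ ^ 2 + ε n by have := hε n; positivity), mul_comm, ← mul_assoc]
      gcongr
      rw [div_le_iff₀ (by have := hε n; positivity)]
      calc |⟪v, x - y⟫| ≤ ‖v‖ * ‖x - y‖⁻¹ * ‖x - y‖ ^ 2 := by
            refine h1.trans (le_of_eq ?_); field_simp
        _ ≤ _ := by gcongr; linarith [hε n]
    · filter_upwards [ae_ne_point y] with x hx
      have hx' := norm_pos_iff.2 (sub_ne_zero.2 hx)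
      have : ⟪v, x - y⟫ / ‖x - y‖ ^ 2 = ⟪v, x - y⟫ / (‖x - y‖ ^ 2 + 0) := by rw [add_zero]
      rw [this]
      exact (tendsto_const_nhds.div (hε0.const_add _) (by positivity)).const_mul _
  exact tendsto_nhds_unique hL (by simpa only [hibp] using hR.neg)

theorem exists_integral_inv_norm_sub_mul_le {h : E4 → ℝ} (hc : Continuous h)
    (hs : HasCompactSupport h) : ∃ M, ∀ y, ∫ x, ‖x - y‖⁻¹ * |h x| ≤ M := by
  obtain ⟨B, hB⟩ := hs.exists_bound_of_continuous hc
  have hfin : volume (tsupport h) ≠ ⊤ := hs.isCompact.measure_lt_top.ne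
  have hB0 : 0 ≤ B := (norm_nonneg _).trans (hB 0)
  refine ⟨B * (volume.real (tsupport h) +
    ∫ z, (ball (0 : E4) 1).indicator (fun z => ‖z‖⁻¹) z), fun y => ?_⟩
  have hsupp : Function.support (fun x => ‖x - y‖⁻¹ * |h x|) ⊆ tsupport h :=
    fun x hx => subset_tsupport h fun h0 => hx (by simp [h0])
  rw [← setIntegral_eq_integral_of_forall_compl_eq_zero
    (fun x hx => Function.notMem_support.1 fun h => hx (hsupp h))]
  have hI := integrableOn_inv_norm_sub hfin y
  calc ∫ x in tsupport h, ‖x - y‖⁻¹ * |h x| ≤ ∫ x in tsupport h, ‖x - y‖⁻¹ * B := by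
        refine integral_mono ?_ (hI.mul_const B) fun x => ?_
        · exact hI.mul_continuousOn hc.abs.continuousOn hs.isCompact
        · dsimp only; gcongr; exact hB x
    _ ≤ _ := by
        rw [integral_mul_const, mul_comm]
        gcongr
        exact setIntegral_inv_norm_sub_le hfin y

/-- Tonelli with x integrated first: the inner integral is bounded uniformly in y, and ρ is
integrable. -/
theorem integrable_prod_inv_norm_sub_mul {h ρ : E4 → ℝ} (hc : Continuous h)
    (hs : HasCompactSupport h) (hρ : Integrable ρ) :
    Integrable (fun p : E4 × E4 => ‖p.1 - p.2‖⁻¹ * h p.1 * ρ p.2) (volume.prod volume) := by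
  have hm : AEStronglyMeasurable (fun p : E4 × E4 => ‖p.1 - p.2‖⁻¹ * h p.1 * ρ p.2)
      (volume.prod volume) :=
    AEStronglyMeasurable.mul (Measurable.aestronglyMeasurable (by fun_prop))
      hρ.aestronglyMeasurable.comp_snd
  rw [integrable_prod_iff' hm]
  refine ⟨Eventually.of_forall fun y => (integrable_inv_norm_sub_mul hc hs y).mul_const (ρ y), ?_⟩
  obtain ⟨M, hM⟩ := exists_integral_inv_norm_sub_mul_le hc hs
  refine Integrable.mono' (hρ.norm.const_mul M) hm.norm.prod_swap.integral_prod_right' ?_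
  refine Eventually.of_forall fun y => ?_
  rw [Real.norm_of_nonneg (integral_nonneg fun x => norm_nonneg _)]
  simp only [norm_mul, norm_inv, norm_norm]
  rw [integral_mul_const]
  gcongr
  exact hM y

theorem integrable_prod_log_mul {h ρ : E4 → ℝ} (hc : Continuous h)
    (hs : HasCompactSupport h) (hρc : Continuous ρ) (hρ : Integrable ρ) :
    Integrable (fun p : E4 × E4 => Real.log (‖p.2‖ / ‖p.1 - p.2‖) * ρ p.2 * h p.1)
      (volume.prod volume) := by
  have h1 := integrable_prod_inv_norm_sub_mul (h := fun x => ‖x‖ * |h x|) (by fun_prop)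
    hs.abs.mul_left hρ.abs
  have h2 : Integrable (fun p : E4 × E4 => (‖p.1‖ * |h p.1|) * (‖p.2‖⁻¹ * |ρ p.2|))
      (volume.prod volume) :=
    Integrable.mul_prod (f := fun x : E4 => ‖x‖ * |h x|) (g := fun y : E4 => ‖y‖⁻¹ * |ρ y|)
      (Continuous.integrable_of_hasCompactSupport (by fun_prop) hs.abs.mul_left)
      (integrable_inv_norm_mul hρc.abs hρ.abs)
  refine (h1.add h2).mono' ?_ (Eventually.of_forall fun p => ?_)
  · exact Measurable.aestronglyMeasurable (by have := hc.measurable; have := hρc.measurable; fun_prop)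
  · have := abs_log_div_norm_le p.1 p.2
    rw [norm_mul, norm_mul, Real.norm_eq_abs, Real.norm_eq_abs, Real.norm_eq_abs]
    calc _ ≤ ‖p.1‖ * (‖p.1 - p.2‖⁻¹ + ‖p.2‖⁻¹) * |ρ p.2| * |h p.1| := by gcongr
      _ = _ := by simp only [Pi.add_apply]; ring

/-- The gradient of a logarithmic potential, in weak form. -/
theorem integral_fderiv_mul_of_log_potential {u ρ g : E4 → ℝ} {c C : ℝ} (hu : ContDiff ℝ 1 u)
    (hρc : Continuous ρ) (hρ : Integrable ρ)
    (heq : ∀ x, u x = c * (∫ y, Real.log (‖y‖ / ‖x - y‖) * ρ y) + C)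
    (hg : ContDiff ℝ 1 g) (hs : HasCompactSupport g) (v : E4) :
    ∫ x, fderiv ℝ u x v * g x =
      -c * ∫ y, (∫ x, g x * (⟪v, x - y⟫ / ‖x - y‖ ^ 2)) * ρ y := by
  have hg' := hg.continuous_fderiv_apply_const v
  have hs' := hs.fderiv_apply_const v
  have h0 := integral_fderiv_eq_zero_of_hasCompactSupport hg hs v
  have hint := hg'.integrable_of_hasCompactSupport hs' (μ := volume)
  have hprod := integrable_prod_log_mul hg' hs' hρc hρ
  -- The part log ‖y‖ of the kernel does not depend on x and integrates to zero against a derivative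
  -- of g; only log ‖x − y‖ contributes.
  have key : ∀ᵐ y : E4, ∫ x, Real.log (‖y‖ / ‖x - y‖) * ρ y * fderiv ℝ g x v =
      (∫ x, g x * (⟪v, x - y⟫ / ‖x - y‖ ^ 2)) * ρ y := by
    filter_upwards [ae_ne_point 0] with y hy
    have hl : Integrable (fun x => Real.log ‖x - y‖ * fderiv ℝ g x v) := by
      refine ((integrable_inv_norm_sub_mul hg'.abs hs'.abs y).add
        (Continuous.integrable_of_hasCompactSupport (f := fun x => ‖x - y‖ * |fderiv ℝ g x v|)
          (by fun_prop) hs'.abs.mul_left)).mono'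
        (AEStronglyMeasurable.mul (Measurable.aestronglyMeasurable (by fun_prop))
          hg'.aestronglyMeasurable) (Eventually.of_forall fun x => ?_)
      rw [norm_mul, Real.norm_eq_abs, Real.norm_eq_abs, Pi.add_apply, ← add_mul]
      gcongr
      rw [add_comm]
      exact abs_log_le_add_inv (norm_nonneg _)
    have e : ∫ x, Real.log (‖y‖ / ‖x - y‖) * ρ y * fderiv ℝ g x v =
        ∫ x, (Real.log ‖y‖ * ρ y * fderiv ℝ g x v - ρ y * (Real.log ‖x - y‖ * fderiv ℝ g x v)) := by
      refine integral_congr_ae ?_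
      filter_upwards [ae_ne_point y] with x hx
      rw [Real.log_div (norm_ne_zero_iff.2 hy) (norm_ne_zero_iff.2 (sub_ne_zero.2 hx))]
      ring
    rw [e, integral_sub (hint.const_mul _) (hl.const_mul _), integral_const_mul, integral_const_mul,
      h0, integral_log_norm_sub_mul_fderiv hg hs]
    ring
  have e1 : ∫ x, u x * fderiv ℝ g x v =
      c * ∫ x, (∫ y, Real.log (‖y‖ / ‖x - y‖) * ρ y * fderiv ℝ g x v) := by
    have : ∀ x, u x * fderiv ℝ g x v =
        c * (∫ y, Real.log (‖y‖ / ‖x - y‖) * ρ y * fderiv ℝ g x v) + C * fderiv ℝ g x v := by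
      intro x; rw [integral_mul_const, heq]; ring
    simp_rw [this]
    rw [integral_add (hprod.integral_prod_left.const_mul c) (hint.const_mul C), integral_const_mul,
      integral_const_mul, h0, mul_zero, add_zero]
  have e2 := integral_mul_fderiv_eq_neg_of_hasCompactSupport hu hg hs v
  rw [← integral_congr_ae key, ← integral_integral_swap hprod, neg_mul, ← e1, e2, neg_neg]

/-! ### Vector fields, divergence and symmetrization -/

/-- The standard orthonormal basis of `ℝ⁴`. -/
noncomputable abbrev stdBasis4 : OrthonormalBasis (Fin 4) ℝ E4 := EuclideanSpace.basisFun (Fin 4) ℝ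

/-- The divergence of a vector field on `ℝ⁴`. -/
noncomputable def divergence4 (ξ : E4 → E4) (x : E4) : ℝ :=
  ∑ i, ⟪stdBasis4 i, fderiv ℝ ξ x (stdBasis4 i)⟫

theorem clm_apply_eq_sum_inner (L : E4 →L[ℝ] ℝ) (z : E4) :
    L z = ∑ i, L (stdBasis4 i) * ⟪stdBasis4 i, z⟫ := by
  conv_lhs => rw [← stdBasis4.sum_repr' z, map_sum]
  exact Finset.sum_congr rfl fun i _ => by rw [map_smul, smul_eq_mul, mul_comm]

theorem inner_eq_sum_stdBasis (z w : E4) :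
    ⟪z, w⟫ = ∑ i, ⟪stdBasis4 i, z⟫ * ⟪stdBasis4 i, w⟫ := by
  rw [← stdBasis4.sum_inner_mul_inner z w]
  exact Finset.sum_congr rfl fun i _ => by rw [real_inner_comm]

section component
variable {ξ : E4 → E4} {ρ : E4 → ℝ}

theorem contDiff_inner_mul (hξ : ContDiff ℝ 1 ξ) (hρ : ContDiff ℝ 1 ρ) (v : E4) :
    ContDiff ℝ 1 (fun x => ⟪v, ξ x⟫ * ρ x) :=
  (contDiff_const.inner ℝ hξ).mul hρ

theorem hasCompactSupport_inner_mul (hs : HasCompactSupport ξ) (ρ : E4 → ℝ) (v : E4) :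
    HasCompactSupport (fun x => ⟪v, ξ x⟫ * ρ x) :=
  (hs.comp_left (g := fun z => ⟪v, z⟫) (inner_zero_right v)).mul_right

end component

theorem integral_fderiv_apply_mul_eq_sum {f ρ : E4 → ℝ} {ξ : E4 → E4} (hf : ContDiff ℝ 1 f)
    (hρ : ContDiff ℝ 1 ρ) (hξ : ContDiff ℝ 1 ξ) (hs : HasCompactSupport ξ) :
    ∫ x, fderiv ℝ f x (ξ x) * ρ x =
      ∑ i, ∫ x, fderiv ℝ f x (stdBasis4 i) * (⟪stdBasis4 i, ξ x⟫ * ρ x) := by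
  rw [← integral_finsetSum]
  · congr 1 with x
    rw [clm_apply_eq_sum_inner, Finset.sum_mul]
    simp only [mul_assoc]
  · intro i _
    exact ((hf.continuous_fderiv_apply_const _).mul
      (contDiff_inner_mul hξ hρ _).continuous).integrable_of_hasCompactSupport
      (hasCompactSupport_inner_mul hs ρ _).mul_left

/-- Integration by parts for a compactly supported vector field. -/
theorem integral_fderiv_apply_mul_eq_neg_divergence {f Q : E4 → ℝ} {ξ : E4 → E4}
    (hf : ContDiff ℝ 1 f) (hQ : ContDiff ℝ 1 Q) (hξ : ContDiff ℝ 1 ξ) (hs : HasCompactSupport ξ) :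
    ∫ x, fderiv ℝ f x (ξ x) * Q x =
      -∫ x, f x * (fderiv ℝ Q x (ξ x) + Q x * divergence4 ξ x) := by
  rw [integral_fderiv_apply_mul_eq_sum hf hQ hξ hs]
  have h : ∀ i, ∫ x, fderiv ℝ f x (stdBasis4 i) * (⟪stdBasis4 i, ξ x⟫ * Q x) =
      -∫ x, f x * fderiv ℝ (fun x => ⟪stdBasis4 i, ξ x⟫ * Q x) x (stdBasis4 i) := fun i => by
    rw [integral_mul_fderiv_eq_neg_of_hasCompactSupport hf (contDiff_inner_mul hξ hQ _)
      (hasCompactSupport_inner_mul hs Q _), neg_neg]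
  simp_rw [h, Finset.sum_neg_distrib]
  rw [← integral_finsetSum]
  · congr 2 with x
    rw [clm_apply_eq_sum_inner (fderiv ℝ Q x), divergence4, Finset.mul_sum, ← Finset.sum_add_distrib,
      Finset.mul_sum]
    refine Finset.sum_congr rfl fun i _ => ?_
    have h1 : HasFDerivAt (fun x => ⟪stdBasis4 i, ξ x⟫) ((innerSL ℝ (stdBasis4 i)).comp (fderiv ℝ ξ x)) x :=
      (innerSL ℝ (stdBasis4 i)).hasFDerivAt.comp x ((hξ.differentiable one_ne_zero) x).hasFDerivAt
    rw [(h1.fun_mul ((hQ.differentiable one_ne_zero) x).hasFDerivAt).fderiv]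
    simp only [add_apply, smul_apply, ContinuousLinearMap.comp_apply, innerSL_apply_apply,
      smul_eq_mul]
    ring
  · intro i _
    exact (hf.continuous.mul ((contDiff_inner_mul hξ hQ _).continuous_fderiv_apply_const _)
      ).integrable_of_hasCompactSupport
      ((hasCompactSupport_inner_mul hs Q _).fderiv_apply_const _).mul_left

theorem integrable_prod_inner_kernel {ρ σ : E4 → ℝ} {ζ : E4 → E4} (hρ : Integrable ρ)
    (hσ : Continuous σ) (hσs : HasCompactSupport σ) (hζ : Continuous ζ) {B : ℝ}
    (hζB : ∀ x, ‖ζ x‖ ≤ B) :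
    Integrable (fun p : E4 × E4 => σ p.1 * (⟪ζ p.1, p.1 - p.2⟫ / ‖p.1 - p.2‖ ^ 2) * ρ p.2)
      (volume.prod volume) := by
  refine ((integrable_prod_inv_norm_sub_mul hσ.abs hσs.abs hρ.abs).const_mul B).mono' ?_
    (Eventually.of_forall fun p => ?_)
  · refine AEStronglyMeasurable.mul (Measurable.aestronglyMeasurable ?_)
      hρ.aestronglyMeasurable.comp_snd
    have := hσ.measurable
    have := hζ.measurable
    fun_prop
  · rw [norm_mul, norm_mul, Real.norm_eq_abs, Real.norm_eq_abs, Real.norm_eq_abs, abs_div,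
      abs_of_nonneg (sq_nonneg ‖p.1 - p.2‖)]
    have h1 : |⟪ζ p.1, p.1 - p.2⟫| / ‖p.1 - p.2‖ ^ 2 ≤ B * ‖p.1 - p.2‖⁻¹ := by
      rcases eq_or_ne ‖p.1 - p.2‖ 0 with h0 | h0
      · simp [h0]
      · have h2 := (abs_real_inner_le_norm (ζ p.1) (p.1 - p.2)).trans
          (mul_le_mul_of_nonneg_right (hζB p.1) (norm_nonneg _))
        rw [div_le_iff₀ (by positivity)]
        refine h2.trans (le_of_eq ?_)
        field_simp
    calc _ ≤ |σ p.1| * (B * ‖p.1 - p.2‖⁻¹) * |ρ p.2| := by gcongr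
      _ = _ := by ring

/-- Since ∇u(x) = −c ∫ (x − y)/|x − y|² ρ(y) dy weakly, and this kernel is odd under exchanging x
and y, ξ(x) may be replaced by (ξ(x) − ξ(y))/2. The new kernel is bounded by the Lipschitz constant
of ξ, so a cutoff in ξ can later be removed using only ρ ∈ L¹. -/
theorem integral_fderiv_apply_mul_symmetrized {u ρ : E4 → ℝ} {ξ : E4 → E4} {c C : ℝ}
    (hu : ContDiff ℝ 1 u) (hρc : ContDiff ℝ 1 ρ) (hρ : Integrable ρ)
    (heq : ∀ x, u x = c * (∫ y, Real.log (‖y‖ / ‖x - y‖) * ρ y) + C)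
    (hξ : ContDiff ℝ 1 ξ) (hs : HasCompactSupport ξ) :
    ∫ x, fderiv ℝ u x (ξ x) * ρ x =
      -(c / 2) * ∫ p : E4 × E4, ⟪ξ p.1 - ξ p.2, p.1 - p.2⟫ / ‖p.1 - p.2‖ ^ 2 * (ρ p.1 * ρ p.2)
        ∂(volume.prod volume) := by
  let F : E4 × E4 → ℝ := fun p => ⟪ξ p.1, p.1 - p.2⟫ / ‖p.1 - p.2‖ ^ 2 * (ρ p.1 * ρ p.2)
  let G : Fin 4 → E4 × E4 → ℝ := fun i p =>
    (⟪stdBasis4 i, ξ p.1⟫ * ρ p.1) * (⟪stdBasis4 i, p.1 - p.2⟫ / ‖p.1 - p.2‖ ^ 2) * ρ p.2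
  have hG : ∀ i, Integrable (G i) (volume.prod volume) := fun i =>
    integrable_prod_inner_kernel (ζ := fun _ => stdBasis4 i) hρ (contDiff_inner_mul hξ hρc _).continuous
      (hasCompactSupport_inner_mul hs ρ _) continuous_const (fun _ => le_rfl)
  have hFG : F = fun p => ∑ i, G i p := by
    funext p
    simp only [F, G]
    rw [inner_eq_sum_stdBasis, Finset.sum_div, Finset.sum_mul]
    exact Finset.sum_congr rfl fun i _ => by ring
  have hF : Integrable F (volume.prod volume) := hFG ▸ integrable_finsetSum _ fun i _ => hG i
  have hmain : ∫ x, fderiv ℝ u x (ξ x) * ρ x = -c * ∫ p, F p ∂(volume.prod volume) := by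
    rw [integral_fderiv_apply_mul_eq_sum hu hρc hξ hs, hFG, integral_finsetSum _ fun i _ => hG i,
      Finset.mul_sum]
    refine Finset.sum_congr rfl fun i _ => ?_
    rw [integral_fderiv_mul_of_log_potential hu hρc.continuous hρ heq (contDiff_inner_mul hξ hρc _)
      (hasCompactSupport_inner_mul hs ρ _), integral_prod_symm _ (hG i)]
    simp only [G, integral_mul_const]
  have hsym : ∫ p : E4 × E4, ⟪ξ p.1 - ξ p.2, p.1 - p.2⟫ / ‖p.1 - p.2‖ ^ 2 * (ρ p.1 * ρ p.2)
      ∂(volume.prod volume) = 2 * ∫ p, F p ∂(volume.prod volume) := by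
    have : ∀ p : E4 × E4, ⟪ξ p.1 - ξ p.2, p.1 - p.2⟫ / ‖p.1 - p.2‖ ^ 2 * (ρ p.1 * ρ p.2) =
        F p + F p.swap := by
      intro p
      simp only [F, Prod.fst_swap, Prod.snd_swap]
      rw [norm_sub_rev p.2 p.1, ← neg_sub p.1 p.2, inner_neg_right, inner_sub_left]
      ring
    simp_rw [this]
    clear_value F
    have hFs : Integrable (fun p : E4 × E4 => F p.swap) (volume.prod volume) := hF.swap
    rw [integral_add hF hFs, integral_prod_swap, two_mul]
  rw [hmain, hsym]
  ring

/-! ### Cutoff of the radial field and the Pohozaev identity -/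

/-- The vector field `x ↦ x - x₀`, cut off at distance of order `n + 1` from `x₀`. -/
noncomputable def cutoffField (φ : ContDiffBump (0 : E4)) (x₀ : E4) (n : ℕ) (x : E4) : E4 :=
  φ (((n : ℝ) + 1)⁻¹ • (x - x₀)) • (x - x₀)

section cutoffField
variable (φ : ContDiffBump (0 : E4)) (x₀ : E4)

theorem contDiff_cutoffField (n : ℕ) : ContDiff ℝ 1 (cutoffField φ x₀ n) := by
  have h1 : ContDiff ℝ 1 (fun x : E4 => x - x₀) := contDiff_id.sub contDiff_const
  have h2 : ContDiff ℝ 1 (fun x : E4 => ((n : ℝ) + 1)⁻¹ • (x - x₀)) :=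
    contDiff_const.fun_smul h1
  have h3 : ContDiff ℝ 1 φ := φ.contDiff
  exact (h3.comp h2).fun_smul h1

theorem hasCompactSupport_cutoffField (n : ℕ) : HasCompactSupport (cutoffField φ x₀ n) := by
  refine HasCompactSupport.intro (isCompact_closedBall x₀ (φ.rOut * (n + 1))) fun x hx => ?_
  have hn : (0 : ℝ) < n + 1 := by positivity
  rw [mem_closedBall, dist_eq_norm, not_le] at hx
  rw [cutoffField, φ.zero_of_le_dist, zero_smul]
  rw [dist_zero_right, norm_smul, norm_inv, Real.norm_of_nonneg hn.le, inv_mul_eq_div,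
    le_div_iff₀ hn]
  exact hx.le

/-- Each field is a translate of s ξ(·/s) for one fixed compactly supported C¹ field ξ, and this
scaling preserves the Lipschitz constant. Uniformity in n supplies the dominating functions below.
-/
theorem exists_lipschitzWith_cutoffField :
    ∃ L : NNReal, ∀ x₀ n, LipschitzWith L (cutoffField φ x₀ n) := by
  obtain ⟨L, hL⟩ := ContDiff.lipschitzWith_of_hasCompactSupport (𝕂 := ℝ)
    (hasCompactSupport_cutoffField φ 0 0) (contDiff_cutoffField φ 0 0) one_ne_zero
  refine ⟨L, fun x₀ n => LipschitzWith.of_dist_le_mul fun x y => ?_⟩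
  have hn : (0 : ℝ) < n + 1 := by positivity
  have h : ∀ x, cutoffField φ x₀ n x =
      ((n : ℝ) + 1) • cutoffField φ 0 0 (((n : ℝ) + 1)⁻¹ • (x - x₀)) := by
    intro x
    simp only [cutoffField, Nat.cast_zero, zero_add, inv_one, sub_zero, one_smul]
    rw [smul_comm, smul_inv_smul₀ hn.ne']
  rw [h, h, dist_smul₀, Real.norm_of_nonneg hn.le]
  calc _ ≤ ((n : ℝ) + 1) * (L * dist (((n : ℝ) + 1)⁻¹ • (x - x₀)) (((n : ℝ) + 1)⁻¹ • (y - x₀))) := by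
        gcongr; exact hL.dist_le_mul _ _
    _ = L * dist x y := by
        rw [dist_smul₀, dist_sub_right, norm_inv, Real.norm_of_nonneg hn.le]
        field_simp

theorem eventually_cutoffField_eventuallyEq (x : E4) :
    ∀ᶠ n in atTop, cutoffField φ x₀ n =ᶠ[𝓝 x] fun y => y - x₀ := by
  obtain ⟨N, hN⟩ := exists_nat_gt (‖x - x₀‖ / φ.rIn)
  filter_upwards [eventually_ge_atTop N] with n hn
  have hn0 : (0 : ℝ) < n + 1 := by positivity
  have hx : ‖x - x₀‖ < φ.rIn * (n + 1) := by
    rw [div_lt_iff₀ φ.rIn_pos] at hN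
    have : (N : ℝ) ≤ n := by exact_mod_cast hn
    nlinarith [φ.rIn_pos]
  have hev : ∀ᶠ y in 𝓝 x, ‖y - x₀‖ < φ.rIn * (n + 1) :=
    ContinuousAt.eventually_lt (by fun_prop) continuousAt_const hx
  filter_upwards [hev] with y hy
  rw [cutoffField, φ.one_of_mem_closedBall, one_smul]
  rw [mem_closedBall, dist_zero_right, norm_smul, norm_inv, Real.norm_of_nonneg hn0.le,
    inv_mul_eq_div, div_le_iff₀ hn0]
  exact hy.le

end cutoffField

theorem divergence4_sub_const (x₀ x : E4) : divergence4 (fun y => y - x₀) x = 4 := by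
  have : fderiv ℝ (fun y : E4 => y - x₀) x = ContinuousLinearMap.id ℝ E4 :=
    ((hasFDerivAt_id x).sub_const x₀).fderiv
  simp only [divergence4, this, ContinuousLinearMap.id_apply, real_inner_self_eq_norm_sq,
    OrthonormalBasis.norm_eq_one]
  simp

theorem continuous_divergence4 {ξ : E4 → E4} (hξ : ContDiff ℝ 1 ξ) : Continuous (divergence4 ξ) := by
  have := hξ.continuous_fderiv one_ne_zero
  unfold divergence4
  fun_prop

theorem abs_divergence4_le {ξ : E4 → E4} {L : NNReal} (hL : LipschitzWith L ξ) (x : E4) :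
    |divergence4 ξ x| ≤ 4 * L := by
  calc |divergence4 ξ x| ≤ ∑ i : Fin 4, |⟪stdBasis4 i, fderiv ℝ ξ x (stdBasis4 i)⟫| :=
        Finset.abs_sum_le_sum_abs _ _
    _ ≤ ∑ _i : Fin 4, (L : ℝ) := Finset.sum_le_sum fun i _ => by
        refine (abs_real_inner_le_norm _ _).trans ?_
        rw [OrthonormalBasis.norm_eq_one, one_mul]
        refine ((fderiv ℝ ξ x).le_opNorm _).trans ?_
        rw [OrthonormalBasis.norm_eq_one, mul_one]
        exact norm_fderiv_le_of_lipschitz ℝ hL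
    _ = 4 * L := by simp

theorem ae_prod_ne : ∀ᵐ p : E4 × E4 ∂(volume.prod volume), p.1 ≠ p.2 := by
  have hm : MeasurableSet {p : E4 × E4 | p.1 ≠ p.2} :=
    (isClosed_eq continuous_fst continuous_snd).isOpen_compl.measurableSet
  rw [Measure.ae_prod_iff_ae_ae hm]
  refine Eventually.of_forall fun x => ?_
  filter_upwards [ae_ne_point x] with y hy using hy.symm

/-- For the field x − x₀ the symmetrized kernel equals 1 off the diagonal, a null set, so the double
integral factors. The Lipschitz bound dominates. -/
theorem tendsto_integral_inner_cutoffField (φ : ContDiffBump (0 : E4)) (x₀ : E4) {ρ : E4 → ℝ}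
    (hρc : Continuous ρ) (hρ : Integrable ρ) :
    Tendsto (fun n => ∫ p : E4 × E4, ⟪cutoffField φ x₀ n p.1 - cutoffField φ x₀ n p.2, p.1 - p.2⟫ /
      ‖p.1 - p.2‖ ^ 2 * (ρ p.1 * ρ p.2) ∂(volume.prod volume)) atTop (𝓝 ((∫ x, ρ x) ^ 2)) := by
  rw [sq, ← integral_prod_mul]
  obtain ⟨L, hL⟩ := exists_lipschitzWith_cutoffField φ
  refine tendsto_integral_of_dominated_convergence (fun p => L * ‖ρ p.1 * ρ p.2‖) ?_ ?_ ?_ ?_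
  · intro n
    refine Measurable.aestronglyMeasurable ?_
    have := (contDiff_cutoffField φ x₀ n).continuous.measurable
    have := hρc.measurable
    fun_prop
  · exact (hρ.mul_prod hρ).norm.const_mul _
  · refine fun n => Eventually.of_forall fun p => ?_
    rw [norm_mul]
    gcongr
    rw [norm_div, norm_pow, norm_norm]
    refine div_le_of_le_mul₀ (by positivity) (by positivity) ((norm_inner_le_norm _ _).trans ?_)
    rw [sq, ← mul_assoc]
    gcongr
    simpa [dist_eq_norm] using (hL x₀ n).dist_le_mul p.1 p.2
  · filter_upwards [ae_prod_ne] with p hp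
    refine tendsto_const_nhds.congr' ?_
    filter_upwards [eventually_cutoffField_eventuallyEq φ x₀ p.1,
      eventually_cutoffField_eventuallyEq φ x₀ p.2] with n h1 h2
    rw [h1.eq_of_nhds, h2.eq_of_nhds, sub_sub_sub_cancel_right, real_inner_self_eq_norm_sq,
      div_self (pow_ne_zero 2 (norm_ne_zero_iff.2 (sub_ne_zero.2 hp))), one_mul]

/-- The cutoff field is a multiple of x − x₀ by a factor in [0, 1], and its divergence is uniformly
bounded with limit 4, so the two integrability hypotheses dominate both terms. -/
theorem tendsto_integral_divergence_cutoffField (φ : ContDiffBump (0 : E4)) (x₀ : E4)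
    {Q w : E4 → ℝ} (hQ : ContDiff ℝ 1 Q) (hw : Continuous w)
    (hρ : Integrable (fun x => Q x * w x))
    (hW : Integrable (fun x => fderiv ℝ Q x (x - x₀) * w x)) :
    Tendsto (fun n => ∫ x, w x * (fderiv ℝ Q x (cutoffField φ x₀ n x) +
      Q x * divergence4 (cutoffField φ x₀ n) x)) atTop
      (𝓝 ((∫ x, fderiv ℝ Q x (x - x₀) * w x) + 4 * ∫ x, Q x * w x)) := by
  rw [← integral_const_mul, ← integral_add hW (hρ.const_mul 4)]
  obtain ⟨L, hL⟩ := exists_lipschitzWith_cutoffField φ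
  refine tendsto_integral_of_dominated_convergence
    (fun x => ‖fderiv ℝ Q x (x - x₀) * w x‖ + 4 * L * ‖Q x * w x‖) ?_ ?_ ?_ ?_
  · intro n
    refine Continuous.aestronglyMeasurable ?_
    have := hQ.continuous_fderiv one_ne_zero
    have := hQ.continuous
    have := (contDiff_cutoffField φ x₀ n).continuous
    have := continuous_divergence4 (contDiff_cutoffField φ x₀ n)
    fun_prop
  · exact hW.norm.add (hρ.norm.const_mul _)
  · refine fun n => Eventually.of_forall fun x => ?_
    have h1 := abs_divergence4_le (hL x₀ n) x
    have h2 : |φ (((n : ℝ) + 1)⁻¹ • (x - x₀))| ≤ 1 := by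
      rw [abs_of_nonneg φ.nonneg]; exact φ.le_one
    rw [cutoffField, map_smul, smul_eq_mul, mul_add]
    refine (norm_add_le _ _).trans (add_le_add ?_ ?_)
    · simp only [norm_mul, Real.norm_eq_abs]
      calc _ ≤ |w x| * (1 * |fderiv ℝ Q x (x - x₀)|) := by gcongr
        _ = _ := by ring
    · simp only [norm_mul, Real.norm_eq_abs]
      calc _ ≤ |w x| * (|Q x| * (4 * L)) := by gcongr
        _ = _ := by ring
  · refine Eventually.of_forall fun x => ?_
    refine tendsto_const_nhds.congr' ?_
    filter_upwards [eventually_cutoffField_eventuallyEq φ x₀ x] with n h1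
    rw [h1.eq_of_nhds, divergence4, h1.fderiv_eq, ← divergence4, divergence4_sub_const]
    ring

/-- **Pohozaev identity** for logarithmic potentials of `Q e^{4u}`. -/
theorem pohozaev_identity {u Q : E4 → ℝ} {c C : ℝ} (x₀ : E4)
    (hu : ContDiff ℝ 1 u) (hQ : ContDiff ℝ 1 Q)
    (hρ : Integrable (fun x => Q x * Real.exp (4 * u x)))
    (heq : ∀ x, u x = c * (∫ y, Real.log (‖y‖ / ‖x - y‖) * (Q y * Real.exp (4 * u y))) + C)
    (hW : Integrable (fun x => fderiv ℝ Q x (x - x₀) * Real.exp (4 * u x))) :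
    (c * ∫ x, Q x * Real.exp (4 * u x)) * ((c * ∫ x, Q x * Real.exp (4 * u x)) - 2) =
      c / 2 * ∫ x, fderiv ℝ Q x (x - x₀) * Real.exp (4 * u x) := by
  let φ : ContDiffBump (0 : E4) := ⟨1, 2, one_pos, one_lt_two⟩
  have hw : ContDiff ℝ 1 (fun x => Real.exp (4 * u x)) := (contDiff_const.mul hu).exp
  have hfd : ∀ x, fderiv ℝ (fun x => Real.exp (4 * u x)) x =
      (4 * Real.exp (4 * u x)) • fderiv ℝ u x := by
    intro x
    have := ((((hu.differentiable one_ne_zero) x).hasFDerivAt.const_mul 4).exp).fderiv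
    rw [this, smul_smul, mul_comm]
  -- Both sequences compute ∫ ξₙ·∇u Q e^{4u}: one by parts, with factor 1/4 from ∇e^{4u} =
  -- 4e^{4u}∇u, the other by symmetrization. Equating the limits gives the identity.
  have hL := (tendsto_integral_divergence_cutoffField φ x₀ hQ hw.continuous hρ hW).const_mul (-(1 / 4))
  have hR := (tendsto_integral_inner_cutoffField φ x₀ (hQ.mul hw).continuous hρ).const_mul (-(c / 2))
  have hLR := tendsto_nhds_unique (hL.congr fun n => ?_) hR
  · linear_combination (2 * c) * hLR
  · have hξ := contDiff_cutoffField φ x₀ n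
    have hs := hasCompactSupport_cutoffField φ x₀ n
    have h1 := integral_fderiv_apply_mul_symmetrized hu (hQ.mul hw) hρ heq hξ hs
    have h2 := integral_fderiv_apply_mul_eq_neg_divergence hw hQ hξ hs
    have h3 : ∫ x, fderiv ℝ (fun x => Real.exp (4 * u x)) x (cutoffField φ x₀ n x) * Q x =
        4 * ∫ x, fderiv ℝ u x (cutoffField φ x₀ n x) * (Q x * Real.exp (4 * u x)) := by
      rw [← integral_const_mul]
      congr 1 with x
      rw [hfd, smul_apply, smul_eq_mul]
      ring
    linear_combination h1 + (1 / 4) * h3 - (1 / 4) * h2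

/-! ### Averages of a logarithmic potential at infinity -/

theorem integral_eq_pow_mul_integral_comp_smul (f : E4 → ℝ) {R : ℝ} (hR : 0 < R) :
    ∫ x, f x = R ^ 4 * ∫ z, f (R • z) := by
  rw [Measure.integral_comp_smul volume f R, smul_eq_mul, finrank_euclideanSpace_fin,
    abs_of_pos (by positivity), mul_inv_cancel_left₀ (by positivity)]

/-- The average of the logarithmic kernel over dilates of the weight `ψ`. -/
noncomputable def logKernelAverage (ψ : E4 → ℝ) (R : ℝ) (y : E4) : ℝ :=
  ∫ z, ψ z * Real.log (‖y‖ / ‖R • z - y‖)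

section
variable {R : ℝ} {y z : E4}

/-- The left side is log ‖y‖ − log ‖z − y/R‖, and ‖y/R‖ ≤ 1 controls the second logarithm from
above. -/
theorem abs_log_add_log_le (hR : 1 ≤ R) (hy : y ≠ 0) (hz : R • z ≠ y) (hyR : ‖y‖ ≤ R) :
    |Real.log (‖y‖ / ‖R • z - y‖) + Real.log R| ≤
      |Real.log ‖y‖| + (1 + ‖z‖) * (1 + ‖z - R⁻¹ • y‖⁻¹) := by
  have hR0 : 0 < R := one_pos.trans_le hR
  have e1 : ‖R • z - y‖ = R * ‖z - R⁻¹ • y‖ := by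
    rw [← Real.norm_of_nonneg hR0.le, ← norm_smul, Real.norm_of_nonneg hR0.le, smul_sub,
      smul_inv_smul₀ hR0.ne']
  have h0 : 0 < ‖R • z - y‖ := norm_pos_iff.2 (sub_ne_zero.2 hz)
  have hzw : 0 < ‖z - R⁻¹ • y‖ := by
    rw [e1] at h0; exact pos_of_mul_pos_right h0 hR0.le
  rw [Real.log_div (norm_ne_zero_iff.2 hy) h0.ne', e1, Real.log_mul hR0.ne' hzw.ne']
  have h1 := abs_log_le_add_inv hzw.le
  have h2 : ‖z - R⁻¹ • y‖ ≤ ‖z‖ + 1 := by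
    refine (norm_sub_le _ _).trans ?_
    rw [norm_smul, norm_inv, Real.norm_of_nonneg hR0.le]
    gcongr
    rw [inv_mul_eq_div]
    exact div_le_one_of_le₀ hyR hR0.le
  have h3 : 0 ≤ ‖z‖ * ‖z - R⁻¹ • y‖⁻¹ := by positivity
  calc _ = |Real.log ‖y‖ - Real.log ‖z - R⁻¹ • y‖| := by congr 1; ring
    _ ≤ |Real.log ‖y‖| + |Real.log ‖z - R⁻¹ • y‖| := abs_sub _ _
    _ ≤ _ := by gcongr; linarith

/-- This covers every nonzero y: the previous estimate when ‖y‖ ≤ R, and `abs_log_div_norm_le` when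
‖y‖ ≥ R. Growth of order log R is what survives the later division by log R. -/
theorem abs_log_kernel_le (hR : 1 ≤ R) (hy : y ≠ 0) (hz : R • z ≠ y) :
    |Real.log (‖y‖ / ‖R • z - y‖)| ≤
      2 * Real.log R + ‖y‖⁻¹ + (1 + ‖z‖) * (1 + ‖z - R⁻¹ • y‖⁻¹) := by
  have hR0 : 0 < R := one_pos.trans_le hR
  have hlR := Real.log_nonneg hR
  have hy0 := norm_pos_iff.2 hy
  have hyi := inv_pos.2 hy0
  rcases le_total ‖y‖ R with hyR | hyR
  · have h1 := abs_log_add_log_le hR hy hz hyR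
    have h2 : |Real.log ‖y‖| ≤ Real.log R + ‖y‖⁻¹ := by
      have := Real.log_le_log hy0 hyR
      have := Real.log_le_sub_one_of_pos hyi
      rw [Real.log_inv] at this
      rw [abs_le]; constructor <;> linarith
    have h3 := abs_add_le (Real.log (‖y‖ / ‖R • z - y‖) + Real.log R) (-Real.log R)
    rw [add_neg_cancel_right, abs_neg, abs_of_nonneg hlR] at h3
    linarith
  · refine (abs_log_div_norm_le (R • z) y).trans ?_
    have e1 : R • z - y = R • (z - R⁻¹ • y) := by rw [smul_sub, smul_inv_smul₀ hR0.ne']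
    rw [e1, norm_smul, norm_smul, Real.norm_of_nonneg hR0.le, mul_inv]
    have h1 : R * ‖y‖⁻¹ ≤ 1 := by rw [← div_eq_mul_inv]; exact div_le_one_of_le₀ hyR hy0.le
    have h2 : 0 ≤ ‖z - R⁻¹ • y‖⁻¹ := by positivity
    calc R * ‖z‖ * (R⁻¹ * ‖z - R⁻¹ • y‖⁻¹ + ‖y‖⁻¹)
        = ‖z‖ * (R * R⁻¹ * ‖z - R⁻¹ • y‖⁻¹ + R * ‖y‖⁻¹) := by ring
      _ ≤ ‖z‖ * (‖z - R⁻¹ • y‖⁻¹ + 1) := by rw [mul_inv_cancel₀ hR0.ne', one_mul]; gcongr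
      _ ≤ _ := by linarith

end

section weight
variable {ψ : E4 → ℝ} (hψc : Continuous ψ) (hψs : HasCompactSupport ψ) (hψ0 : ∀ z, 0 ≤ ψ z)
  (hψ1 : ∫ z, ψ z = 1)
include hψc hψs

/-- Fubini against the rescaled weight R⁻⁴ψ(x/R) moves the average from u onto the kernel. -/
theorem integral_mul_comp_smul_eq {u ρ : E4 → ℝ} {c C : ℝ}
    (hρc : Continuous ρ) (hρ : Integrable ρ)
    (heq : ∀ x, u x = c * (∫ y, Real.log (‖y‖ / ‖x - y‖) * ρ y) + C) {R : ℝ} (hR : 0 < R) :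
    Integrable (fun y => logKernelAverage ψ R y * ρ y) ∧
    ∫ z, ψ z * u (R • z) = c * (∫ y, logKernelAverage ψ R y * ρ y) + C * ∫ z, ψ z := by
  let h : E4 → ℝ := fun x => (R ^ 4)⁻¹ * ψ (R⁻¹ • x)
  have hR4 : R ^ 4 ≠ 0 := by positivity
  have hc : Continuous h := by fun_prop
  have hs : HasCompactSupport h :=
    (hψs.comp_homeomorph (Homeomorph.smulOfNeZero R⁻¹ (inv_ne_zero hR.ne'))).mul_left
  have hh : ∀ f : E4 → ℝ, ∫ x, f x * h x = ∫ z, ψ z * f (R • z) := by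
    intro f
    rw [integral_eq_pow_mul_integral_comp_smul _ hR, ← integral_const_mul]
    congr 1 with z
    simp only [h, inv_smul_smul₀ hR.ne']
    field_simp
  have hprod := integrable_prod_log_mul hc hs hρc hρ
  have hK : ∀ y, ∫ x, Real.log (‖y‖ / ‖x - y‖) * ρ y * h x = logKernelAverage ψ R y * ρ y := by
    intro y
    rw [hh (fun x => Real.log (‖y‖ / ‖x - y‖) * ρ y), logKernelAverage, ← integral_mul_const]
    congr 1 with z
    ring
  have hI := hprod.integral_prod_right
  simp only [hK] at hI
  refine ⟨hI, ?_⟩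
  have h1 := hh (fun _ => 1)
  simp only [one_mul, mul_one] at h1
  have hu : ∀ x, u x * h x =
      c * (∫ y, Real.log (‖y‖ / ‖x - y‖) * ρ y * h x) + C * h x := by
    intro x; rw [integral_mul_const, heq]; ring
  rw [← hh u, ← h1]
  simp_rw [hu]
  rw [integral_add (hprod.integral_prod_left.const_mul c)
    ((hc.integrable_of_hasCompactSupport hs).const_mul C), integral_const_mul, integral_const_mul,
    integral_integral_swap hprod]
  simp_rw [hK]

include hψ0 hψ1

/-- Integrating the pointwise bounds against ψ absorbs the moving singularity at z = y/R into a
constant, uniformly in R and y. The first bound identifies the limit, the second dominates. -/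
theorem exists_logKernelAverage_bound : ∃ M, 0 ≤ M ∧ ∀ R : ℝ, 1 ≤ R → ∀ y : E4, y ≠ 0 →
    (‖y‖ ≤ R → |logKernelAverage ψ R y + Real.log R| ≤ |Real.log ‖y‖| + M) ∧
      |logKernelAverage ψ R y| ≤ 2 * Real.log R + ‖y‖⁻¹ + M := by
  have hgc : Continuous (fun z : E4 => ψ z * (1 + ‖z‖)) := by fun_prop
  have hgs : HasCompactSupport (fun z : E4 => ψ z * (1 + ‖z‖)) := hψs.mul_right
  have hgi := hgc.integrable_of_hasCompactSupport hgs (μ := volume)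
  have hψi := hψc.integrable_of_hasCompactSupport hψs (μ := volume)
  obtain ⟨M, hM⟩ := exists_integral_inv_norm_sub_mul_le hgc hgs
  let e : E4 → E4 → ℝ := fun w z => ψ z * ((1 + ‖z‖) * (1 + ‖z - w‖⁻¹))
  have he' : ∀ w z, e w z = ψ z * (1 + ‖z‖) + ‖z - w‖⁻¹ * |ψ z * (1 + ‖z‖)| := by
    intro w z
    rw [abs_of_nonneg (mul_nonneg (hψ0 z) (by positivity))]
    simp only [e]; ring
  have hei : ∀ w, Integrable (e w) := by
    intro w
    rw [funext (he' w)]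
    exact hgi.add (integrable_inv_norm_sub_mul hgc.abs hgs.abs w)
  have heM : ∀ w, ∫ z, e w z ≤ (∫ z, ψ z * (1 + ‖z‖)) + M := by
    intro w
    rw [integral_congr_ae (Eventually.of_forall (he' w)),
      integral_add hgi (integrable_inv_norm_sub_mul hgc.abs hgs.abs w)]
    gcongr
    exact hM w
  have he0 : 0 ≤ ∫ z, e 0 z :=
    integral_nonneg fun z => mul_nonneg (hψ0 z) (by positivity)
  refine ⟨(∫ z, ψ z * (1 + ‖z‖)) + M, he0.trans (heM 0), fun R hR y hy => ?_⟩
  have hR0 : 0 < R := one_pos.trans_le hR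
  have hae : ∀ᵐ z : E4, R • z ≠ y := by
    filter_upwards [ae_ne_point (R⁻¹ • y)] with z hz h
    exact hz (by rw [← h, inv_smul_smul₀ hR0.ne'])
  have hint : Integrable (fun z => ψ z * Real.log (‖y‖ / ‖R • z - y‖)) := by
    refine ((hψi.mul_const (2 * Real.log R + ‖y‖⁻¹)).add (hei (R⁻¹ • y))).mono'
      (hψc.aestronglyMeasurable.mul (Measurable.aestronglyMeasurable (by fun_prop))) ?_
    filter_upwards [hae] with z hz
    rw [norm_mul, Real.norm_of_nonneg (hψ0 z), Pi.add_apply, ← mul_add]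
    exact mul_le_mul_of_nonneg_left (abs_log_kernel_le hR hy hz) (hψ0 z)
  constructor
  · intro hyR
    have e1 : logKernelAverage ψ R y + Real.log R =
        ∫ z, ψ z * (Real.log (‖y‖ / ‖R • z - y‖) + Real.log R) := by
      simp_rw [mul_add]
      rw [integral_add hint (hψi.mul_const _), integral_mul_const, hψ1, one_mul, logKernelAverage]
    have h2 : ‖∫ z, ψ z * (Real.log (‖y‖ / ‖R • z - y‖) + Real.log R)‖ ≤
        ∫ z, (ψ z * |Real.log ‖y‖| + e (R⁻¹ • y) z) := by
      refine norm_integral_le_of_norm_le ((hψi.mul_const _).add (hei _)) ?_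
      filter_upwards [hae] with z hz
      rw [norm_mul, Real.norm_of_nonneg (hψ0 z), ← mul_add]
      exact mul_le_mul_of_nonneg_left (abs_log_add_log_le hR hy hz hyR) (hψ0 z)
    rw [integral_add (hψi.mul_const _) (hei _), integral_mul_const, hψ1, one_mul] at h2
    rw [e1]
    exact h2.trans (by gcongr; exact heM _)
  · have h2 : ‖logKernelAverage ψ R y‖ ≤
        ∫ z, (ψ z * (2 * Real.log R + ‖y‖⁻¹) + e (R⁻¹ • y) z) := by
      refine norm_integral_le_of_norm_le ((hψi.mul_const _).add (hei _)) ?_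
      filter_upwards [hae] with z hz
      rw [norm_mul, Real.norm_of_nonneg (hψ0 z), ← mul_add]
      exact mul_le_mul_of_nonneg_left (abs_log_kernel_le hR hy hz) (hψ0 z)
    rw [integral_add (hψi.mul_const _) (hei _), integral_mul_const, hψ1, one_mul] at h2
    exact h2.trans (by gcongr; exact heM _)

theorem tendsto_logKernelAverage_div_log {y : E4} (hy : y ≠ 0) :
    Tendsto (fun R => logKernelAverage ψ R y / Real.log R) atTop (𝓝 (-1)) := by
  obtain ⟨M, -, hM⟩ := exists_logKernelAverage_bound hψc hψs hψ0 hψ1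
  have h0 : Tendsto (fun R => (|Real.log ‖y‖| + M) / Real.log R) atTop (𝓝 0) :=
    tendsto_const_nhds.div_atTop Real.tendsto_log_atTop
  rw [tendsto_iff_dist_tendsto_zero]
  refine squeeze_zero' (Eventually.of_forall fun _ => dist_nonneg) ?_ h0
  filter_upwards [eventually_ge_atTop 1, eventually_ge_atTop ‖y‖,
    Real.tendsto_log_atTop.eventually_gt_atTop 0] with R hR hyR hl
  have := (hM R hR y hy).1 hyR
  rw [Real.dist_eq, sub_neg_eq_add, div_add_one hl.ne', abs_div, abs_of_pos hl]
  gcongr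

/-- Weighted means of a logarithmic potential decay like `-α log R`, where `α` is the total mass. -/
theorem tendsto_integral_mul_comp_smul_div_log {u ρ : E4 → ℝ} {c C : ℝ}
    (hρc : Continuous ρ) (hρ : Integrable ρ)
    (heq : ∀ x, u x = c * (∫ y, Real.log (‖y‖ / ‖x - y‖) * ρ y) + C) :
    Tendsto (fun R : ℝ => (∫ z, ψ z * u (R • z)) / Real.log R) atTop (𝓝 (-(c * ∫ y, ρ y))) := by
  obtain ⟨M, hM0, hM⟩ := exists_logKernelAverage_bound hψc hψs hψ0 hψ1
  have h1 : Tendsto (fun R : ℝ => ∫ y, logKernelAverage ψ R y / Real.log R * ρ y) atTop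
      (𝓝 (∫ y, -1 * ρ y)) := by
    refine tendsto_integral_filter_of_dominated_convergence
      (fun y => (2 + M) * |ρ y| + ‖y‖⁻¹ * |ρ y|) ?_ ?_ ?_ ?_
    · filter_upwards [eventually_gt_atTop 0] with R hR
      have := ((integral_mul_comp_smul_eq hψc hψs hρc hρ heq hR).1.div_const
        (Real.log R)).aestronglyMeasurable
      simpa only [div_mul_eq_mul_div] using this
    · filter_upwards [eventually_ge_atTop 1, Real.tendsto_log_atTop.eventually_ge_atTop 1]
        with R hR hl
      filter_upwards [ae_ne_point 0] with y hy
      rw [norm_mul, norm_div, ← add_mul, Real.norm_eq_abs, Real.norm_eq_abs, Real.norm_eq_abs,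
        abs_of_pos (one_pos.trans_le hl)]
      gcongr
      rw [div_le_iff₀ (one_pos.trans_le hl)]
      refine (hM R hR y hy).2.trans ?_
      have : 0 ≤ ‖y‖⁻¹ := by positivity
      nlinarith
    · exact (hρ.abs.const_mul _).add (integrable_inv_norm_mul hρc.abs hρ.abs)
    · filter_upwards [ae_ne_point 0] with y hy
      exact (tendsto_logKernelAverage_div_log hψc hψs hψ0 hψ1 hy).mul_const _
  have h2 : Tendsto (fun R : ℝ => C / Real.log R) atTop (𝓝 0) :=
    tendsto_const_nhds.div_atTop Real.tendsto_log_atTop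
  have h3 := (h1.const_mul c).add h2
  rw [integral_const_mul, add_zero, neg_one_mul, mul_neg] at h3
  refine h3.congr' ?_
  filter_upwards [eventually_gt_atTop 0] with R hR
  rw [(integral_mul_comp_smul_eq hψc hψs hρc hρ heq hR).2, hψ1, mul_one, add_div, mul_div_assoc,
    ← integral_div]
  simp only [div_mul_eq_mul_div]

end weight

/-! ### Jensen's inequality and the lower bound for the mass -/

/-- Jensen's inequality for the exponential and a compactly supported weight. -/
theorem exp_integral_mul_le {ψ v : E4 → ℝ} (hψc : Continuous ψ) (hψs : HasCompactSupport ψ)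
    (hψ0 : ∀ z, 0 ≤ ψ z) (hψ1 : ∫ z, ψ z = 1) (hv : Continuous v) :
    Real.exp (∫ z, ψ z * v z) ≤ ∫ z, ψ z * Real.exp (v z) := by
  set a := ∫ z, ψ z * v z with ha
  have i1 : Integrable (fun z => ψ z * v z) :=
    (hψc.mul hv).integrable_of_hasCompactSupport hψs.mul_right
  have i2 := hψc.integrable_of_hasCompactSupport hψs (μ := volume)
  have i3 : Integrable (fun z => ψ z * Real.exp (v z)) :=
    Continuous.integrable_of_hasCompactSupport (by fun_prop) hψs.mul_right
  -- The integrand is ψ times the tangent line of exp at the mean a, which lies below exp.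
  have h1 : ∫ z, Real.exp a * (ψ z * v z + ψ z * (1 - a)) = Real.exp a := by
    rw [integral_const_mul, integral_add i1 (i2.mul_const _), integral_mul_const, hψ1, ← ha]
    ring
  rw [← h1]
  refine integral_mono ((i1.add (i2.mul_const _)).const_mul _) i3 fun z => ?_
  have h2 := Real.add_one_le_exp (v z - a)
  have h3 : Real.exp (v z) = Real.exp a * Real.exp (v z - a) := by rw [← Real.exp_add]; ring_nf
  dsimp only
  rw [h3]
  calc _ = ψ z * (Real.exp a * (v z - a + 1)) := by ring
    _ ≤ _ := by
      have := hψ0 z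
      gcongr

/-- If `|Q|` grows like `|x|^m` in some open cone and `Q e^{4u}` is integrable, the total mass of
the logarithmic potential `u` is at least `1 + m / 4`. -/
theorem one_add_div_four_le_of_growth {u Q : E4 → ℝ} {c C : ℝ} (hu : Continuous u)
    (hQ : Continuous Q) (hρ : Integrable (fun x => Q x * Real.exp (4 * u x)))
    (heq : ∀ x, u x = c * (∫ y, Real.log (‖y‖ / ‖x - y‖) * (Q y * Real.exp (4 * u y))) + C)
    {m : ℕ} {p : E4} {r κ : ℝ} (hr : 0 < r) (hκ : 0 < κ)
    (hgrow : ∀ᶠ R : ℝ in atTop, ∀ z ∈ ball p r, κ * R ^ m ≤ |Q (R • z)|) :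
    1 + (m : ℝ) / 4 ≤ c * ∫ x, Q x * Real.exp (4 * u x) := by
  let φ : ContDiffBump p := ⟨r / 2, r, half_pos hr, half_lt_self hr⟩
  let ψ : E4 → ℝ := φ.normed volume
  have hψc : Continuous ψ := φ.continuous_normed
  have hψs : HasCompactSupport ψ := φ.hasCompactSupport_normed
  have hψ0 : ∀ z, 0 ≤ ψ z := φ.nonneg_normed
  have hψ1 : ∫ z, ψ z = 1 := φ.integral_normed
  have hρc : Continuous (fun x => Q x * Real.exp (4 * u x)) := by fun_prop
  obtain ⟨B, hB⟩ := hψs.exists_bound_of_continuous hψc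
  have hB0 : 0 ≤ B := (norm_nonneg _).trans (hB 0)
  set D := B * ∫ x, |Q x * Real.exp (4 * u x)|
  have hD : 0 ≤ D := mul_nonneg hB0 (integral_nonneg fun x => abs_nonneg _)
  have hlim := tendsto_integral_mul_comp_smul_div_log hψc hψs hψ0 hψ1 hρc hρ heq
  -- Jensen, the growth of Q and the change of variables x = Rz bound R^{m+4} exp(4 ∫ ψ u(R·))
  -- independently of R. Taking logarithms and dividing by log R leaves m + 4 − 4α ≤ 0 in the limit.
  have hlim2 : Tendsto (fun R : ℝ => ((m : ℝ) + 4) + 4 * ((∫ z, ψ z * u (R • z)) / Real.log R))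
      atTop (𝓝 (((m : ℝ) + 4) + 4 * (-(c * ∫ x, Q x * Real.exp (4 * u x))))) :=
    (hlim.const_mul 4).const_add _
  have hlim3 : Tendsto (fun R : ℝ => Real.log ((D + 1) / κ) / Real.log R) atTop (𝓝 0) :=
    tendsto_const_nhds.div_atTop Real.tendsto_log_atTop
  have hle := le_of_tendsto_of_tendsto hlim2 hlim3 ?_
  · linarith
  filter_upwards [hgrow, eventually_ge_atTop 1, Real.tendsto_log_atTop.eventually_gt_atTop 0]
    with R hgR hR hl
  have hR0 : 0 < R := one_pos.trans_le hR
  have j1 := exp_integral_mul_le hψc hψs hψ0 hψ1 (v := fun z => 4 * u (R • z)) (by fun_prop)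
  have j2 : ∫ z, ψ z * (4 * u (R • z)) = 4 * ∫ z, ψ z * u (R • z) := by
    rw [← integral_const_mul]; congr 1 with z; ring
  rw [j2] at j1
  have j3 : κ * R ^ m * ∫ z, ψ z * Real.exp (4 * u (R • z)) ≤
      ∫ z, ψ z * |Q (R • z) * Real.exp (4 * u (R • z))| := by
    rw [← integral_const_mul]
    refine integral_mono ?_ ?_ fun z => ?_
    · exact (Continuous.integrable_of_hasCompactSupport (by fun_prop) hψs.mul_right).const_mul _
    · exact Continuous.integrable_of_hasCompactSupport (by fun_prop) hψs.mul_right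
    · dsimp only
      by_cases hz : z ∈ ball p r
      · rw [abs_mul, Real.abs_exp]
        have h1 := hgR z hz
        have h2 := hψ0 z
        calc _ = ψ z * ((κ * R ^ m) * Real.exp (4 * u (R • z))) := by ring
          _ ≤ _ := by gcongr
      · have : ψ z = 0 := by
          rw [← Function.notMem_support, φ.support_normed_eq]; exact hz
        simp [this]
  have j4 : R ^ 4 * ∫ z, ψ z * |Q (R • z) * Real.exp (4 * u (R • z))| ≤ D := by
    have h1 := integral_eq_pow_mul_integral_comp_smul
      (fun x => ψ (R⁻¹ • x) * |Q x * Real.exp (4 * u x)|) hR0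
    simp only [inv_smul_smul₀ hR0.ne'] at h1
    rw [← h1]
    simp only [D]
    rw [← integral_const_mul]
    refine integral_mono_of_nonneg (Eventually.of_forall fun x => mul_nonneg (hψ0 _) (abs_nonneg _))
      (hρ.abs.const_mul B) (Eventually.of_forall fun x => ?_)
    dsimp only
    gcongr
    exact (le_abs_self _).trans (hB _)
  have j5 : R ^ (m + 4) * Real.exp (4 * ∫ z, ψ z * u (R • z)) ≤ (D + 1) / κ := by
    rw [le_div_iff₀ hκ]
    calc _ = R ^ 4 * (κ * R ^ m * Real.exp (4 * ∫ z, ψ z * u (R • z))) := by ring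
      _ ≤ R ^ 4 * (κ * R ^ m * ∫ z, ψ z * Real.exp (4 * u (R • z))) := by gcongr
      _ ≤ R ^ 4 * ∫ z, ψ z * |Q (R • z) * Real.exp (4 * u (R • z))| := by gcongr
      _ ≤ D + 1 := by linarith
  have j6 := Real.log_le_log (by positivity) j5
  rw [Real.log_mul (by positivity) (by positivity), Real.log_exp, Real.log_pow] at j6
  rw [le_div_iff₀ hl]
  push_cast at j6
  refine le_trans (le_of_eq ?_) j6
  field_simp

/-! ### Growth and parity of polynomials -/

theorem MvPolynomial.IsHomogeneous.eval_const_mul {φ : MvPolynomial (Fin 4) ℝ} {n : ℕ}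
    (hφ : φ.IsHomogeneous n) (s : ℝ) (x : Fin 4 → ℝ) :
    MvPolynomial.eval (fun i => s * x i) φ = s ^ n * MvPolynomial.eval x φ := by
  rw [MvPolynomial.eval_eq', MvPolynomial.eval_eq', Finset.mul_sum]
  refine Finset.sum_congr rfl fun d hd => ?_
  have hdeg : ∑ i, d i = n := by
    rw [← hφ (MvPolynomial.mem_support_iff.1 hd), ← Finsupp.degree_eq_sum]
    exact DFunLike.congr_fun Finsupp.degree_eq_weight_one d
  simp only [mul_pow, Finset.prod_mul_distrib, Finset.prod_pow_eq_pow_sum, hdeg]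
  ring

theorem MvPolynomial.homogeneousComponent_totalDegree_ne_zero {Q : MvPolynomial (Fin 4) ℝ}
    (hQ : Q ≠ 0) : MvPolynomial.homogeneousComponent Q.totalDegree Q ≠ 0 := by
  obtain ⟨d, hd, hdeg⟩ := Finset.exists_mem_eq_sup Q.support (MvPolynomial.support_nonempty.2 hQ)
    (fun s => s.sum fun _ e => e)
  intro h
  have h1 := congrArg (MvPolynomial.coeff d) h
  rw [MvPolynomial.coeff_homogeneousComponent, if_pos, MvPolynomial.coeff_zero] at h1
  · exact MvPolynomial.mem_support_iff.1 hd h1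
  · rw [MvPolynomial.totalDegree, hdeg]; rfl

theorem contDiff_eval (Q : MvPolynomial (Fin 4) ℝ) :
    ContDiff ℝ 1 (fun x : E4 => MvPolynomial.eval (fun i => x i) Q) := by
  simp only [MvPolynomial.eval_eq']
  refine ContDiff.sum fun d _ => contDiff_const.mul (contDiff_prod fun i _ => ContDiff.pow ?_ _)
  fun_prop

/-- The polynomial `Q` rescaled at infinity: `s ^ m * Q (x / s)` where `m` is the degree of `Q`. -/
noncomputable def rescaledAtInfinity (Q : MvPolynomial (Fin 4) ℝ) (s : ℝ) (x : E4) : ℝ :=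
  ∑ k ∈ Finset.range (Q.totalDegree + 1),
    s ^ (Q.totalDegree - k) * MvPolynomial.eval (fun i => x i) (MvPolynomial.homogeneousComponent k Q)

section rescaled
variable (Q : MvPolynomial (Fin 4) ℝ)

theorem continuous_rescaledAtInfinity :
    Continuous (fun q : ℝ × E4 => rescaledAtInfinity Q q.1 q.2) := by
  unfold rescaledAtInfinity
  refine continuous_finsetSum _ fun k _ => (continuous_fst.pow _).mul ?_
  exact (contDiff_eval (MvPolynomial.homogeneousComponent k Q)).continuous.comp continuous_snd

theorem rescaledAtInfinity_zero (x : E4) : rescaledAtInfinity Q 0 x =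
    MvPolynomial.eval (fun i => x i) (MvPolynomial.homogeneousComponent Q.totalDegree Q) := by
  rw [rescaledAtInfinity, Finset.sum_range_succ, Finset.sum_eq_zero, zero_add, Nat.sub_self,
    pow_zero, one_mul]
  intro k hk
  rw [zero_pow (Nat.sub_ne_zero_of_lt (Finset.mem_range.1 hk)), zero_mul]

theorem eval_smul_eq_rescaledAtInfinity {R : ℝ} (hR : R ≠ 0) (x : E4) :
    MvPolynomial.eval (fun i => (R • x) i) Q = R ^ Q.totalDegree * rescaledAtInfinity Q R⁻¹ x := by
  conv_lhs => rw [← MvPolynomial.sum_homogeneousComponent Q]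
  rw [map_sum, rescaledAtInfinity, Finset.mul_sum]
  refine Finset.sum_congr rfl fun k hk => ?_
  have hk' : k ≤ Q.totalDegree := Nat.lt_succ_iff.1 (Finset.mem_range.1 hk)
  have h1 : R ^ Q.totalDegree = R ^ k * R ^ (Q.totalDegree - k) := by
    rw [← pow_add, Nat.add_sub_cancel' hk']
  have h2 := (MvPolynomial.homogeneousComponent_isHomogeneous k Q).eval_const_mul R (fun i => x i)
  simp only [PiLp.smul_apply, smul_eq_mul]
  rw [h2, h1, inv_pow]
  have := pow_ne_zero (Q.totalDegree - k) hR
  field_simp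

/-- Take p where the leading form does not vanish. Joint continuity of the rescaled polynomial at
(0, p) keeps it away from zero for small s = 1/R and all z in a fixed ball around p. -/
theorem exists_growth {Q : MvPolynomial (Fin 4) ℝ} (hQ : Q ≠ 0) :
    ∃ (p : E4) (r κ : ℝ), 0 < r ∧ 0 < κ ∧ ∀ᶠ R : ℝ in atTop, ∀ z ∈ ball p r,
      κ * R ^ Q.totalDegree ≤ |MvPolynomial.eval (fun i => (R • z) i) Q| := by
  obtain ⟨p, hp⟩ : ∃ p : Fin 4 → ℝ,
      MvPolynomial.eval p (MvPolynomial.homogeneousComponent Q.totalDegree Q) ≠ 0 := by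
    by_contra! h
    exact MvPolynomial.homogeneousComponent_totalDegree_ne_zero hQ
      ((MvPolynomial.homogeneousComponent_isHomogeneous _ Q).eq_zero_of_forall_eval_eq_zero h)
  have h0 : rescaledAtInfinity Q 0 (WithLp.toLp 2 p) ≠ 0 := by rwa [rescaledAtInfinity_zero]
  set t := |rescaledAtInfinity Q 0 (WithLp.toLp 2 p)| with ht
  have ht0 : 0 < t := abs_pos.2 h0
  have hev : ∀ᶠ q : ℝ × E4 in 𝓝 (0, WithLp.toLp 2 p), t / 2 < |rescaledAtInfinity Q q.1 q.2| :=
    continuous_const.continuousAt.eventually_lt (continuous_rescaledAtInfinity Q).abs.continuousAt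
      (half_lt_self ht0)
  rw [nhds_prod_eq] at hev
  obtain ⟨U, hU, V, hV, hUV⟩ := eventually_prod_iff.1 hev
  obtain ⟨r, hr, hrV⟩ := Metric.eventually_nhds_iff_ball.1 hV
  refine ⟨WithLp.toLp 2 p, r, t / 2, hr, half_pos ht0, ?_⟩
  filter_upwards [tendsto_inv_atTop_zero.eventually hU, eventually_gt_atTop 0] with R hR hR0 z hz
  rw [eval_smul_eq_rescaledAtInfinity Q hR0.ne', abs_mul, abs_of_pos (by positivity), mul_comm]
  gcongr
  exact (hUV hR (hrV z hz)).le

/-- An upper bound on Q makes its leading form nonpositive everywhere; if the form were odd,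
comparing p with −p would make it vanish. -/
theorem even_totalDegree_of_eval_le {Q : MvPolynomial (Fin 4) ℝ} (hQ : Q ≠ 0) {b : ℝ}
    (hb : ∀ x : E4, MvPolynomial.eval (fun i => x i) Q ≤ b) : Even Q.totalDegree := by
  by_contra hodd
  rw [Nat.not_even_iff_odd] at hodd
  have hle : ∀ x : E4, rescaledAtInfinity Q 0 x ≤ 0 := by
    intro x
    have h1 : Tendsto (fun R : ℝ => rescaledAtInfinity Q R⁻¹ x) atTop
        (𝓝 (rescaledAtInfinity Q 0 x)) :=
      ((continuous_rescaledAtInfinity Q).comp (Continuous.prodMk_left x)).continuousAt.tendsto.comp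
        tendsto_inv_atTop_zero
    have h2 : Tendsto (fun R : ℝ => b / R ^ Q.totalDegree) atTop (𝓝 0) :=
      tendsto_const_nhds.div_atTop (tendsto_pow_atTop hodd.pos.ne')
    refine le_of_tendsto_of_tendsto h1 h2 ?_
    filter_upwards [eventually_gt_atTop 0] with R hR
    rw [le_div_iff₀ (by positivity), mul_comm, ← eval_smul_eq_rescaledAtInfinity Q hR.ne']
    exact hb _
  refine MvPolynomial.homogeneousComponent_totalDegree_ne_zero hQ
    ((MvPolynomial.homogeneousComponent_isHomogeneous _ Q).eq_zero_of_forall_eval_eq_zero fun p => ?_)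
  have h1 := hle (WithLp.toLp 2 p)
  have h2 := hle (WithLp.toLp 2 fun i => -1 * p i)
  have h3 := (MvPolynomial.homogeneousComponent_isHomogeneous Q.totalDegree Q).eval_const_mul (-1) p
  rw [rescaledAtInfinity_zero] at h1 h2
  rw [hodd.neg_one_pow] at h3
  simp only at h1 h2
  rw [h3] at h2
  linarith

end rescaled

/-! ### Quadratic functions and their centre -/

/-- Functions on `ℝ⁴` that are polynomials of degree at most two, in invariant form. -/
def IsQuadraticFunction (f : E4 → ℝ) : Prop :=
  ∃ (a : ℝ) (b : E4) (T : E4 →ₗ[ℝ] E4), T.IsSymmetric ∧ ∀ x, f x = a + ⟪b, x⟫ + ⟪T x, x⟫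

theorem IsQuadraticFunction.add {f g : E4 → ℝ} (hf : IsQuadraticFunction f)
    (hg : IsQuadraticFunction g) : IsQuadraticFunction (fun x => f x + g x) := by
  obtain ⟨a, b, T, hT, h⟩ := hf
  obtain ⟨a', b', T', hT', h'⟩ := hg
  refine ⟨a + a', b + b', T + T', hT.add hT', fun x => ?_⟩
  dsimp only
  rw [h, h', inner_add_left, LinearMap.add_apply, inner_add_left]
  ring

theorem IsQuadraticFunction.const_mul {f : E4 → ℝ} (hf : IsQuadraticFunction f) (s : ℝ) :
    IsQuadraticFunction (fun x => s * f x) := by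
  obtain ⟨a, b, T, hT, h⟩ := hf
  refine ⟨s * a, s • b, s • T, hT.smul (by simp), fun x => ?_⟩
  dsimp only
  rw [h, real_inner_smul_left, LinearMap.smul_apply, real_inner_smul_left]
  ring

theorem isQuadraticFunction_const (a : ℝ) : IsQuadraticFunction fun _ => a :=
  ⟨a, 0, 0, LinearMap.IsSymmetric.zero, fun x => by simp⟩

theorem isQuadraticFunction_inner (b : E4) : IsQuadraticFunction fun x => ⟪b, x⟫ :=
  ⟨0, b, 0, LinearMap.IsSymmetric.zero, fun x => by simp⟩

theorem isQuadraticFunction_inner_mul_inner (v w : E4) :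
    IsQuadraticFunction fun x => ⟪v, x⟫ * ⟪w, x⟫ := by
  refine ⟨0, 0, (2⁻¹ : ℝ) • ((innerₛₗ ℝ v).smulRight w + (innerₛₗ ℝ w).smulRight v), ?_, ?_⟩
  · intro x y
    simp only [LinearMap.smul_apply, LinearMap.add_apply, LinearMap.smulRight_apply,
      innerₛₗ_apply_apply, real_inner_smul_left, real_inner_smul_right, inner_add_left,
      inner_add_right, real_inner_comm x]
    ring
  · intro x
    simp only [LinearMap.smul_apply, LinearMap.add_apply, LinearMap.smulRight_apply,
      innerₛₗ_apply_apply, real_inner_smul_left, inner_add_left, inner_zero_left]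
    ring

theorem prod_pow_add_single (d : Fin 4 →₀ ℕ) (i : Fin 4) (x : E4) :
    ∏ j, x j ^ ((d + Finsupp.single i 1 : Fin 4 →₀ ℕ) j) = (∏ j, x j ^ d j) * ⟪stdBasis4 i, x⟫ := by
  simp only [Finsupp.add_apply, pow_add, Finset.prod_mul_distrib]
  congr 1
  rw [Finset.prod_eq_single i]
  · rw [Finsupp.single_eq_same, pow_one, EuclideanSpace.basisFun_inner]
  · intro j _ hj; simp [hj.symm]
  · simp

theorem exists_eq_add_single {d : Fin 4 →₀ ℕ} (hd : d ≠ 0) :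
    ∃ (e : Fin 4 →₀ ℕ) (i : Fin 4), d = e + Finsupp.single i 1 ∧ d.degree = e.degree + 1 := by
  obtain ⟨i, hi⟩ := Finsupp.ne_iff.1 hd
  have h : d = (d - Finsupp.single i 1) + Finsupp.single i 1 := by
    rw [tsub_add_cancel_of_le]
    rw [Finsupp.single_le_iff]
    exact Nat.one_le_iff_ne_zero.2 hi
  refine ⟨d - Finsupp.single i 1, i, h, ?_⟩
  conv_lhs => rw [h, map_add, Finsupp.degree_single]

/-- Stripping off one variable at a time, each monomial of degree at most two is 1, a linear form or
a product of two. -/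
theorem isQuadraticFunction_eval {Q : MvPolynomial (Fin 4) ℝ} (hQ : Q.totalDegree ≤ 2) :
    IsQuadraticFunction (fun x => MvPolynomial.eval (fun i => x i) Q) := by
  have hmon : ∀ d : Fin 4 →₀ ℕ, d.degree ≤ 2 →
      IsQuadraticFunction (fun x => ∏ i, x i ^ d i) := by
    intro d hd
    by_cases h0 : d = 0
    · subst h0
      simpa using isQuadraticFunction_const 1
    obtain ⟨e, i, rfl, hdeg⟩ := exists_eq_add_single h0
    simp_rw [prod_pow_add_single]
    by_cases h1 : e = 0
    · subst h1
      simpa using isQuadraticFunction_inner (stdBasis4 i)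
    obtain ⟨e', j, rfl, hdeg'⟩ := exists_eq_add_single h1
    have h2 : e' = 0 := by rw [← Finsupp.degree_eq_zero_iff]; omega
    subst h2
    simp_rw [prod_pow_add_single]
    simpa using isQuadraticFunction_inner_mul_inner (stdBasis4 j) (stdBasis4 i)
  have hsum : ∀ s ⊆ Q.support,
      IsQuadraticFunction (fun x => ∑ d ∈ s, Q.coeff d * ∏ i, x i ^ d i) := by
    intro s
    induction s using Finset.induction_on with
    | empty => intro _; simpa using isQuadraticFunction_const 0
    | insert d s hds ih =>
      intro hs
      simp_rw [Finset.sum_insert hds]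
      refine IsQuadraticFunction.add ((hmon d ?_).const_mul _)
        (ih ((Finset.subset_insert d s).trans hs))
      exact (MvPolynomial.le_totalDegree (hs (Finset.mem_insert_self d s))).trans hQ
  simpa only [MvPolynomial.eval_eq'] using hsum _ subset_rfl

/-- A quadratic function bounded above is centred at a maximum point. -/
theorem IsQuadraticFunction.exists_center {f : E4 → ℝ} (hf : IsQuadraticFunction f) {B : ℝ}
    (hB : ∀ x, f x ≤ B) :
    ∃ x₀, (∀ x, f x ≤ f x₀) ∧ ∀ x, fderiv ℝ f x (x - x₀) = 2 * (f x - f x₀) := by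
  obtain ⟨a, b, T, hT, h⟩ := hf
  have hline : ∀ {k l : ℝ}, (∀ t : ℝ, a + k * t + l * t ^ 2 ≤ B) → l ≤ 0 ∧ (l = 0 → k = 0) := by
    intro k l hkl
    constructor
    · by_contra! hl
      -- Two opposite points are used because the sign of k is unknown; their bounds add up without
      -- the linear term.
      have h1 := hkl ((|k| + |B - a| + 1) / l + 1)
      have h1' := hkl (-((|k| + |B - a| + 1) / l + 1))
      set t := (|k| + |B - a| + 1) / l with ht
      have htl : l * t = |k| + |B - a| + 1 := by rw [ht]; field_simp
      have ht0 : 0 ≤ t := by positivity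
      have := le_abs_self (B - a)
      have := abs_nonneg k
      nlinarith [abs_nonneg (B - a)]
    · rintro rfl
      by_contra hk
      have h1 := hkl ((B - a + 1) / k)
      rw [mul_div_cancel₀ _ hk] at h1
      linarith
  have hexp : ∀ (v : E4) (t : ℝ), f (t • v) = a + ⟪b, v⟫ * t + ⟪T v, v⟫ * t ^ 2 := by
    intro v t
    rw [h, map_smul, real_inner_smul_right, real_inner_smul_right, real_inner_smul_left]
    ring
  have hneg : ∀ v, ⟪T v, v⟫ ≤ 0 := fun v => (hline fun t => by rw [← hexp]; exact hB _).1
  -- On ker T the function is affine and bounded above, so b is orthogonal to ker T. As T is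
  -- symmetric, b = Tw for some w, and x₀ = −w/2 solves b + 2Tx₀ = 0.
  have hker : b ∈ (LinearMap.ker T)ᗮ := by
    rw [Submodule.mem_orthogonal']
    intro v hv
    refine (hline (k := ⟪b, v⟫) (l := ⟪T v, v⟫) fun t => by rw [← hexp]; exact hB _).2 ?_
    rw [LinearMap.mem_ker.1 hv, inner_zero_left]
  rw [LinearMap.orthogonal_ker, hT.adjoint_eq] at hker
  obtain ⟨w, hw⟩ := hker
  set x₀ : E4 := -((2⁻¹ : ℝ) • w) with hx₀
  have hTx₀ : T x₀ = -((2⁻¹ : ℝ) • b) := by rw [hx₀, map_neg, map_smul, hw]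
  have hcen : ∀ x, f x = f x₀ + ⟪T (x - x₀), x - x₀⟫ := by
    intro x
    have e1 : ⟪T x, x₀⟫ = -(2⁻¹ * ⟪b, x⟫) := by
      rw [hT x x₀, hTx₀, inner_neg_right, real_inner_smul_right, real_inner_comm]
    rw [h x, h x₀, map_sub]
    simp only [inner_sub_left, inner_sub_right]
    rw [e1, hTx₀]
    simp only [inner_neg_left, real_inner_smul_left]
    ring
  refine ⟨x₀, fun x => by rw [hcen x]; linarith [hneg (x - x₀)], fun x => ?_⟩
  have hd : HasFDerivAt (fun x : E4 => x - x₀) (ContinuousLinearMap.id ℝ E4) x :=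
    (hasFDerivAt_id x).sub_const x₀
  have hTd : HasFDerivAt (fun x : E4 => T (x - x₀)) (T.toContinuousLinearMap) x :=
    T.toContinuousLinearMap.hasFDerivAt.comp x hd
  have hfd := (hTd.inner ℝ hd).const_add (f x₀)
  rw [← funext hcen] at hfd
  rw [hfd.fderiv, hcen x]
  simp [fderivInnerCLM_apply, two_mul]

/-! ### Comparison with the volume of the sphere -/

theorem volS4_ne_top : volS4 ≠ ⊤ := measure_ne_top _ _

theorem volS4_toReal_pos : 0 < volS4.toReal := by
  refine ENNReal.toReal_pos ?_ volS4_ne_top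
  rw [volS4, Ne, Measure.measure_univ_eq_zero]
  exact Measure.toSphere_ne_zero _

section volume
variable {u : E4 → ℝ} {c C S : ℝ}

theorem integral_exp_eq_of_const {a : ℝ} (hu : ContDiff ℝ 1 u)
    (hw : Integrable fun x => Real.exp (4 * u x)) (hc : c * (6 * S) = 2) (hc0 : 0 < c)
    (heq : ∀ x, u x = c * (∫ y, Real.log (‖y‖ / ‖x - y‖) * (a * Real.exp (4 * u y))) + C) :
    a * ∫ x, Real.exp (4 * u x) = 6 * S := by
  have hV : 0 < ∫ x, Real.exp (4 * u x) := integral_exp_pos hw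
  -- For a = 0 the function u would be constant, and e^{4u} would not be integrable. This excludes
  -- the root α = 0 of α(α − 2) = 0.
  have ha : a ≠ 0 := by
    rintro rfl
    have huC : u = fun _ => C := by
      funext x; simpa using heq x
    rw [huC, integrable_const_iff] at hw
    rcases hw with hw | hw
    · exact (Real.exp_pos _).ne' hw
    · exact (measure_lt_top (volume : Measure E4) univ).ne (by simp)
  have hp := pohozaev_identity (Q := fun _ => a) 0 hu contDiff_const (hw.const_mul a) heq (by simp)
  simp only [fderiv_const_apply, zero_apply, zero_mul, integral_zero, mul_zero,
    integral_const_mul] at hp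
  rcases mul_eq_zero.1 hp with h | h
  · exact absurd h (mul_ne_zero hc0.ne' (mul_ne_zero ha hV.ne'))
  · exact mul_left_cancel₀ hc0.ne' (by linarith)

/-- Strictness comes from 6 − Q, which is continuous, nonnegative and somewhere nonzero. -/
theorem lt_integral_exp_of_two_le {Q : E4 → ℝ} (hu : Continuous u) (hQc : Continuous Q)
    (hw : Integrable fun x => Real.exp (4 * u x))
    (hρ : Integrable fun x => Q x * Real.exp (4 * u x)) (hc : c * (6 * S) = 2) (hc0 : 0 < c)
    (hQ : ∀ x, Q x ≤ 6) (hne : ∃ x, Q x ≠ 6) (hα : 2 ≤ c * ∫ x, Q x * Real.exp (4 * u x)) :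
    S < ∫ x, Real.exp (4 * u x) := by
  obtain ⟨x₀, hx₀⟩ := hne
  have h1 : 0 < ∫ x, (6 * Real.exp (4 * u x) - Q x * Real.exp (4 * u x)) := by
    refine integral_pos_of_integrable_nonneg_nonzero (x := x₀) (by fun_prop)
      ((hw.const_mul 6).sub hρ) (fun x => ?_) ?_
    · simp only [Pi.zero_apply, ← sub_mul]
      exact mul_nonneg (sub_nonneg.2 (hQ x)) (Real.exp_pos _).le
    · rw [← sub_mul]
      exact mul_ne_zero (sub_ne_zero.2 hx₀.symm) (Real.exp_pos _).ne'
  rw [integral_sub (hw.const_mul 6) hρ, integral_const_mul] at h1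
  have h2 : 6 * S ≤ ∫ x, Q x * Real.exp (4 * u x) := le_of_mul_le_mul_left (hc.trans_le hα) hc0
  linarith

theorem lt_integral_exp_of_quadratic {Q : E4 → ℝ} (hu : ContDiff ℝ 1 u) (hQc : ContDiff ℝ 1 Q)
    (hw : Integrable fun x => Real.exp (4 * u x))
    (hρ : Integrable fun x => Q x * Real.exp (4 * u x)) (hc : c * (6 * S) = 2) (hc0 : 0 < c)
    (heq : ∀ x, u x = c * (∫ y, Real.log (‖y‖ / ‖x - y‖) * (Q y * Real.exp (4 * u y))) + C)
    (hquad : IsQuadraticFunction Q) (hQ : ∀ x, Q x ≤ 6) (hne : ∀ a, ∃ x, Q x ≠ a)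
    (hα : 1 < c * ∫ x, Q x * Real.exp (4 * u x)) :
    S < ∫ x, Real.exp (4 * u x) := by
  obtain ⟨x₀, hmax, hfd⟩ := hquad.exists_center hQ
  have hV : 0 < ∫ x, Real.exp (4 * u x) := integral_exp_pos hw
  obtain ⟨x₁, hx₁⟩ := hne (Q x₀)
  have h1 : 0 < ∫ x, (Q x₀ * Real.exp (4 * u x) - Q x * Real.exp (4 * u x)) := by
    have := hu.continuous
    have := hQc.continuous
    refine integral_pos_of_integrable_nonneg_nonzero (x := x₁) (by fun_prop)
      ((hw.const_mul _).sub hρ) (fun x => ?_) ?_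
    · simp only [Pi.zero_apply, ← sub_mul]
      exact mul_nonneg (sub_nonneg.2 (hmax x)) (Real.exp_pos _).le
    · rw [← sub_mul]
      exact mul_ne_zero (sub_ne_zero.2 hx₁.symm) (Real.exp_pos _).ne'
  have hW : ∀ x, fderiv ℝ Q x (x - x₀) * Real.exp (4 * u x) =
      2 * (Q x * Real.exp (4 * u x) - Q x₀ * Real.exp (4 * u x)) := fun x => by rw [hfd]; ring
  have hWi : Integrable (fun x => fderiv ℝ Q x (x - x₀) * Real.exp (4 * u x)) := by
    simp_rw [hW]
    exact (hρ.sub (hw.const_mul _)).const_mul 2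
  have hp := pohozaev_identity x₀ hu hQc hρ heq hWi
  simp_rw [hW] at hp
  rw [integral_const_mul, integral_sub hρ (hw.const_mul _), integral_const_mul] at hp
  rw [integral_sub (hw.const_mul _) hρ, integral_const_mul] at h1
  set V := ∫ x, Real.exp (4 * u x)
  set I := ∫ x, Q x * Real.exp (4 * u x)
  have h2 : c * I < 2 := by
    have h3 : 0 < c * (Q x₀ * V - I) := mul_pos hc0 h1
    have h4 : c * I * (c * I - 2) < 0 := by rw [hp]; linarith
    by_contra! h5
    exact absurd h4 (not_lt.2 (mul_nonneg (by linarith) (by linarith)))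
  -- With α = cI the Pohozaev identity is c Q(x₀) V = α(3 − α), and this product is α(3 − α) − 2.
  have h3 : 0 < (c * I - 1) * (2 - c * I) := mul_pos (by linarith) (by linarith)
  have h4 : c * (6 * S) < c * (Q x₀ * V) := by linarith
  have h5 : 6 * S < Q x₀ * V := lt_of_mul_lt_mul_left h4 hc0.le
  have h6 : Q x₀ * V ≤ 6 * V := by gcongr; exact hQ x₀
  linarith

end volume

theorem exists_eval_ne_of_totalDegree_ne_zero {Q : MvPolynomial (Fin 4) ℝ}
    (hQ : Q.totalDegree ≠ 0) (a : ℝ) : ∃ x : E4, MvPolynomial.eval (fun i => x i) Q ≠ a := by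
  by_contra! h
  refine hQ ?_
  have : Q = MvPolynomial.C a := MvPolynomial.funext fun p => by
    rw [MvPolynomial.eval_C]; exact h (WithLp.toLp 2 p)
  rw [this, MvPolynomial.totalDegree_C]

theorem theorem1p2 (Q : MvPolynomial (Fin 4) ℝ) (u : E4 → ℝ)
    (hu : IsNormalSolution (fun x => MvPolynomial.eval (fun i => x i) Q) u)
    (hQ : ∀ x : E4, MvPolynomial.eval (fun i => x i) Q ≤ 6) :
    volS4 ≤ ∫⁻ x : E4, ENNReal.ofReal (Real.exp (4 * u x)) ∧
      ((∫⁻ x : E4, ENNReal.ofReal (Real.exp (4 * u x))) = volS4 ↔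
        ∀ x : E4, MvPolynomial.eval (fun i => x i) Q = 6) := by
  obtain ⟨hsm, hρ, -, C, heq⟩ := hu
  have hu1 : ContDiff ℝ 1 u := hsm.of_le (by exact_mod_cast le_top)
  have hS := volS4_toReal_pos
  set S := volS4.toReal with hSdef
  have hSv : volS4 = ENNReal.ofReal S := (ENNReal.ofReal_toReal volS4_ne_top).symm
  have hc0 : 0 < 2 / (6 * S) := by positivity
  have hc : 2 / (6 * S) * (6 * S) = 2 := div_mul_cancel₀ _ (by positivity)
  generalize 2 / (6 * S) = c at hc0 hc heq
  have hwc : Continuous fun x => Real.exp (4 * u x) := by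
    have := hu1.continuous
    fun_prop
  by_cases hw : Integrable fun x => Real.exp (4 * u x)
  swap
  · have htop : ∫⁻ x : E4, ENNReal.ofReal (Real.exp (4 * u x)) = ⊤ := by
      by_contra h
      exact hw ((lintegral_ofReal_ne_top_iff_integrable hwc.aestronglyMeasurable
        (Eventually.of_forall fun x => (Real.exp_pos _).le)).1 h)
    rw [htop]
    -- When V is infinite, Q ≡ 6 cannot occur: Q e^{4u} ∈ L¹ would make e^{4u} integrable.
    refine ⟨le_top, fun h => absurd h.symm volS4_ne_top, fun h => absurd ?_ hw⟩
    simp only [h] at hρ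
    simpa using hρ.const_mul 6⁻¹
  have hV : 0 < ∫ x, Real.exp (4 * u x) := integral_exp_pos hw
  rw [← ofReal_integral_eq_lintegral_ofReal hw (Eventually.of_forall fun x => (Real.exp_pos _).le),
    hSv, ENNReal.ofReal_le_ofReal_iff hV.le, ENNReal.ofReal_eq_ofReal_iff hV.le hS.le]
  by_cases h6 : ∀ x : E4, MvPolynomial.eval (fun i => x i) Q = 6
  · simp only [h6] at heq
    have := integral_exp_eq_of_const hu1 hw hc hc0 heq
    have hVS : ∫ x, Real.exp (4 * u x) = S := by linarith
    exact ⟨hVS.ge, fun _ => h6, fun _ => hVS⟩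
  suffices h : S < ∫ x, Real.exp (4 * u x) from
    ⟨h.le, fun h' => absurd h' h.ne', fun h' => absurd h' h6⟩
  by_cases hdeg : Q.totalDegree = 0
  · rw [MvPolynomial.totalDegree_eq_zero_iff_eq_C] at hdeg
    generalize MvPolynomial.coeff 0 Q = a at hdeg
    subst hdeg
    simp only [MvPolynomial.eval_C] at heq h6 hQ
    have h1 := integral_exp_eq_of_const hu1 hw hc hc0 heq
    have ha : a < 6 := lt_of_le_of_ne (hQ 0) fun h => h6 fun _ => h
    nlinarith
  have hQ0 : Q ≠ 0 := by rintro rfl; exact hdeg MvPolynomial.totalDegree_zero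
  have hcont := contDiff_eval Q
  obtain ⟨p, r, κ, hr, hκ, hgrow⟩ := exists_growth hQ0
  have hα := one_add_div_four_le_of_growth hu1.continuous hcont.continuous hρ heq hr hκ hgrow
  -- Evenness rules out degree 3, where growth alone would give only α ≥ 7/4; beyond degree 2 the
  -- degree is at least 4 and α ≥ 2.
  obtain ⟨k, hk⟩ := even_totalDegree_of_eval_le hQ0 hQ
  rcases le_or_gt Q.totalDegree 2 with h2 | h2
  · refine lt_integral_exp_of_quadratic hu1 hcont hw hρ hc hc0 heq (isQuadraticFunction_eval h2) hQ
      (exists_eval_ne_of_totalDegree_ne_zero hdeg) (lt_of_lt_of_le ?_ hα)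
    have : (0 : ℝ) < Q.totalDegree := by exact_mod_cast Nat.pos_of_ne_zero hdeg
    linarith
  · refine lt_integral_exp_of_two_le hu1.continuous hcont.continuous hw hρ hc hc0 hQ
      (exists_eval_ne_of_totalDegree_ne_zero hdeg 6) (le_trans ?_ hα)
    have : (4 : ℝ) ≤ Q.totalDegree := by exact_mod_cast (by omega : 4 ≤ Q.totalDegree)
    linarith
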